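/- **Setting.** Let $\mathcal N$ be a smooth $\mathfrak n$-dimensional manifold. *Null metric hypersurface data* $\{\mathcal N,\gamma,\boldsymbol\ell,\ell^{(2)}\}$ consists of a smooth symmetric $(0,2)$-tensor field $\gamma$ of signature $(0,+,\dots,+)$, a smooth covector field $\boldsymbol\ell$ and a smooth function $\ell^{(2)}$ such that the $(\mathfrak n+1)\times(\mathfrak n+1)$ matrix $$\mathcal A=\begin{pmatrix}\gamma_{ab}&\ell_a\\ \ell_b&\ell^{(2)}\end{pmatrix}$$ is non-degenerate everywhere. The blocks of $\mathcal A^{-1}$ define a symmetric $(2,0)$-tensor field $P^{ab}$ (upper diagonal block) and a vector field $n^a$ (off-diagonal block), so that $\gamma_{ab}n^b=0$, $\ell_an^a=1$, $P^{ab}\ell_b+\ell^{(2)}n^a=0$, $P^{ab}\gamma_{bc}+n^a\ell_c=\delta^a_c$. A *$\mathcal K$-tuple* $\{\mathcal N,\gamma,\boldsymbol\ell,\ell^{(2)},\mathbf Y,\alpha,\mathfrak p,\boldsymbol{\mathfrak q}\}$ is null metric hypersurface data together with a smooth symmetric $(0,2)$-tensor field $\mathbf Y$, smooth functions $\alpha,\mathfrak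 p$ and a smooth covector field $\boldsymbol{\mathfrak q}$ (all given in a fixed gauge). Put $$\mathbf F=\tfrac12 d\boldsymbol\ell,\quad \boldsymbol s=\mathbf F(n,\cdot),\quad \mathbf U=\tfrac12\pounds_n\gamma,\quad \boldsymbol r=\mathbf Y(n,\cdot),\quad \boldsymbol\omega=\boldsymbol s-\boldsymbol r,\quad \kappa_n=-\mathbf Y(n,n),$$ $$\overline\eta=\alpha n,\qquad \kappa=n(\alpha)+\alpha\kappa_n .$$ Here $(d\boldsymbol\ell)(X,W)=X(\boldsymbol\ell(W))-W(\boldsymbol\ell(X))-\boldsymbol\ell([X,W])$. Round brackets around indices denote symmetrization with weight $\tfrac12$, and $\mathrm{tr}_P\mathbf T=P^{ab}T_{ab}$. Let $\mathring\nabla$ be the *metric hypersurface connection*, i.e. the unique torsion-free connection on $\mathcal N$ with $$\mathring\nabla_a\gamma_{bc}=-\ell_b U_{ac}-\ell_c U_{ab},\qquad \mathring\nabla_a\ell_b=F_{ab}-\ell^{(2)}U_{ab},$$ let $\mathring R_{bd}=\mathring R^a{}_{bad}$ be its Ricci tensor, where the curvature is $R(X,W)Z=(\nabla_X\nabla_W-\nabla_W\nabla_X-\nabla_{[X,W]})Z$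 and $R^a{}_{bcd}$ are the components of $R(\partial_c,\partial_d)\partial_b$, and let $\overline\nabla_XW=\mathring\nabla_XW-\mathbf Y(X,W)\,n$. The *constraint tensor* is $$\begin{aligned}\mathcal R_{ab}={}&\mathring R_{(ab)}-2(\pounds_n\mathbf Y)_{ab}-\big(2\boldsymbol\omega(n)+\mathrm{tr}_P\mathbf U\big)Y_{ab}-2\mathring\nabla_{(a}\omega_{b)}-2\omega_a\omega_b+3\mathring\nabla_{(a}s_{b)}+s_as_b\\&-(\mathrm{tr}_P\mathbf Y)U_{ab}+2P^{cd}U_{d(a}\big(2Y_{b)c}+F_{b)c}\big).\end{aligned}$$ The Lie derivative of $\overline\nabla$ along $\overline\eta$ is $\overline\Sigma(X,W)=\pounds_{\overline\eta}(\overline\nabla_XW)-\overline\nabla_X(\pounds_{\overline\eta}W)-\overline\nabla_{\pounds_{\overline\eta}X}W$, and the *non-isolation tensor* is $$\boldsymbol\Pi=\boldsymbol\ell(\overline\Sigma)-\tfrac12\big(\alpha\, n(\ell^{(2)})-\mathfrak p\big)\mathbf U-\alpha\,\ell^{(2)}\pounds_n\mathbf U .$$ **Theorem (generalized near-horizon equation).**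 For every $\mathcal K$-tuple the following identities hold everywhere on $\mathcal N$: $$\begin{aligned} 0={}&\mathring\nabla_a\mathring\nabla_b\alpha+2\omega_{(a}\mathring\nabla_{b)}\alpha+\frac\alpha2\Big(2\mathring\nabla_{(a}\omega_{b)}+2\omega_a\omega_b+\mathcal R_{ab}-\mathring R_{(ab)}\Big)+\Big(\kappa+\frac\alpha2\,\mathrm{tr}_P\mathbf U\Big)Y_{ab}\\ &+\frac\alpha2(\mathrm{tr}_P\mathbf Y)U_{ab}-2\alpha P^{cd}U_{c(a}Y_{b)d}-\Pi_{ab}+\frac\alpha2\Big(\mathring\nabla_{(a}s_{b)}-s_as_b\Big)+\frac12\Big(\alpha\,n(\ell^{(2)})+\mathfrak p\Big)U_{ab}-\alpha P^{cd}U_{c(a}F_{b)d}, \end{aligned}$$ $$0=\mathring\nabla_a\kappa+\alpha\Big(\mathcal R_{ab}n^b-(\mathrm{tr}_P\mathbf U)\omega_a+\mathring\nabla_a(\mathrm{tr}_P\mathbf U)\Big)-P^{bc}\mathring\nabla_b(\alpha U_{ac})-\Pi_{ab}n^b,$$ $$0=n(\kappa)-\Pi_{ab}n^an^b .$$ No topological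 condition on $\mathcal N$, no field equation and no condition on the zeros of $\overline\eta$ is assumed. -/

import Mathlib

open Bundle VectorField FiberBundle
open scoped ContDiff Manifold

namespace NullHypersurface

noncomputable section

/-! ### Vector fields and tensor fields on an `m`-dimensional manifold -/

section Basic

variable (m : ℕ) (N : Type*) [TopologicalSpace N] [ChartedSpace (EuclideanSpace ℝ (Fin m)) N]

/-- Sections of `TN`, without any regularity. -/
abbrev VField := Π x : N, TangentSpace (𝓡 m) x

/-- Fields of real-valued functions of one tangent vector (covector fields are of this kind). -/
abbrev Form1 := Π x : N, TangentSpace (𝓡 m) x → ℝ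

/-- Fields of real-valued functions of two tangent vectors (`(0,2)`-tensor fields are of this
kind). -/
abbrev Tensor2 := Π x : N, TangentSpace (𝓡 m) x → TangentSpace (𝓡 m) x → ℝ

variable [IsManifold (𝓡 m) ∞ N]

/-- Smoothness of a covector field. -/
def SmoothForm1 (θ : Π x : N, TangentSpace (𝓡 m) x →L[ℝ] ℝ) : Prop :=
  ContMDiff (𝓡 m) ((𝓡 m).prod 𝓘(ℝ, EuclideanSpace ℝ (Fin m) →L[ℝ] ℝ)) ∞
    (fun x ↦ TotalSpace.mk' (EuclideanSpace ℝ (Fin m) →L[ℝ] ℝ)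
      (E := fun x : N ↦ TangentSpace (𝓡 m) x →L[ℝ] ℝ) x (θ x))

/-- Smoothness of a `(0,2)`-tensor field. -/
def SmoothTensor2
    (T : Π x : N, TangentSpace (𝓡 m) x →L[ℝ] TangentSpace (𝓡 m) x →L[ℝ] ℝ) : Prop :=
  ContMDiff (𝓡 m)
    ((𝓡 m).prod 𝓘(ℝ, EuclideanSpace ℝ (Fin m) →L[ℝ] EuclideanSpace ℝ (Fin m) →L[ℝ] ℝ)) ∞
    (fun x ↦ TotalSpace.mk' (EuclideanSpace ℝ (Fin m) →L[ℝ] EuclideanSpace ℝ (Fin m) →L[ℝ] ℝ)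
      (E := fun x : N ↦ TangentSpace (𝓡 m) x →L[ℝ] TangentSpace (𝓡 m) x →L[ℝ] ℝ) x (T x))

variable {m N}

/-- Differentiability of a vector field at a point. -/
def DiffVF (V : VField m N) (x : N) : Prop :=
  MDifferentiableAt (𝓡 m) ((𝓡 m).prod 𝓘(ℝ, EuclideanSpace ℝ (Fin m)))
    (fun y ↦ TotalSpace.mk' (EuclideanSpace ℝ (Fin m)) y (V y)) x

/-- A vector field, smooth near `x`, that extends the tangent vector `v` at `x`. All uses below are
tensorial, so that the choice of the extension is irrelevant. -/
def ext {x : N} (v : TangentSpace (𝓡 m) x) : VField m N := extend (EuclideanSpace ℝ (Fin m)) v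

/-- The basis vector `e_a` of `T_x N` (in the preferred chart at `x`). -/
def e (x : N) (a : Fin m) : TangentSpace (𝓡 m) x := EuclideanSpace.single a (1 : ℝ)

/-- The component `v^a` of a tangent vector in the basis `e_a`. -/
def co {x : N} (v : TangentSpace (𝓡 m) x) (a : Fin m) : ℝ := (show EuclideanSpace ℝ (Fin m) from v) a

end Basic

section LinearAlgebra

variable {m : ℕ} {N : Type*} [TopologicalSpace N] [ChartedSpace (EuclideanSpace ℝ (Fin m)) N]

lemma sum_co_smul_e {x : N} (v : TangentSpace (𝓡 m) x) : ∑ a, co v a • e x a = v := by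
  change ∑ a, co v a • EuclideanSpace.single a (1 : ℝ) = (show EuclideanSpace ℝ (Fin m) from v)
  ext i
  simp [co, Finset.sum_apply, Pi.single_apply]

lemma co_add {x : N} (v w : TangentSpace (𝓡 m) x) (a : Fin m) : co (v + w) a = co v a + co w a :=
  rfl

lemma co_smul {x : N} (c : ℝ) (v : TangentSpace (𝓡 m) x) (a : Fin m) :
    co (c • v) a = c * co v a := rfl

lemma co_sum_smul_e (x : N) (c : Fin m → ℝ) (b : Fin m) : co (∑ a, c a • e x a) b = c b := by
  change (∑ a, c a • EuclideanSpace.single a (1 : ℝ) : EuclideanSpace ℝ (Fin m)) b = c b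
  simp [Finset.sum_apply, Pi.single_apply]

lemma ext_of_co {x : N} {v w : TangentSpace (𝓡 m) x} (h : ∀ a, co v a = co w a) : v = w := by
  rw [← sum_co_smul_e v, ← sum_co_smul_e w]; simp [h]

end LinearAlgebra

/-! ### Null metric hypersurface data -/

/-- Null metric hypersurface data `{N, γ, ℓ, ℓ⁽²⁾}`: `γ` is a smooth symmetric `(0,2)`-tensor field
of signature `(0,+,…,+)`, `ℓ` a smooth covector field and `ℓ⁽²⁾` a smooth function such that the
square matrix with blocks `γ_ab`, `ℓ_a`, `ℓ_b`, `ℓ⁽²⁾` is non-degenerate everywhere. -/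
structure NullMetricData (m : ℕ) (N : Type*) [TopologicalSpace N]
    [ChartedSpace (EuclideanSpace ℝ (Fin m)) N] [IsManifold (𝓡 m) ∞ N] where
  γ : Π x : N, TangentSpace (𝓡 m) x →L[ℝ] TangentSpace (𝓡 m) x →L[ℝ] ℝ
  ell : Π x : N, TangentSpace (𝓡 m) x →L[ℝ] ℝ
  ell2 : N → ℝ
  smooth_γ : SmoothTensor2 m N γ
  smooth_ell : SmoothForm1 m N ell
  smooth_ell2 : ContMDiff (𝓡 m) 𝓘(ℝ, ℝ) ∞ ell2
  symm_γ : ∀ x v w, γ x v w = γ x w v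
  nonneg_γ : ∀ x v, 0 ≤ γ x v v
  radical_γ : ∀ x, Module.finrank ℝ (LinearMap.ker (γ x).toLinearMap) = 1
  nondegenerate : ∀ x, IsUnit (Matrix.fromBlocks
    (Matrix.of fun a b ↦ γ x (e x a) (e x b)) (Matrix.of fun a (_ : Unit) ↦ ell x (e x a))
    (Matrix.of fun (_ : Unit) b ↦ ell x (e x b))
    (Matrix.of fun (_ : Unit) (_ : Unit) ↦ ell2 x)).det

namespace NullMetricData

variable {m : ℕ} {N : Type*} [TopologicalSpace N] [ChartedSpace (EuclideanSpace ℝ (Fin m)) N]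
  [IsManifold (𝓡 m) ∞ N] (D : NullMetricData m N)

/-- The matrix `𝓐` with blocks `γ_ab`, `ℓ_a`, `ℓ_b`, `ℓ⁽²⁾`. -/
def A (x : N) : Matrix (Fin m ⊕ Unit) (Fin m ⊕ Unit) ℝ :=
  Matrix.fromBlocks
    (Matrix.of fun a b ↦ D.γ x (e x a) (e x b)) (Matrix.of fun a (_ : Unit) ↦ D.ell x (e x a))
    (Matrix.of fun (_ : Unit) b ↦ D.ell x (e x b))
    (Matrix.of fun (_ : Unit) (_ : Unit) ↦ D.ell2 x)

/-- The components `P^{ab}`: the first diagonal block of `𝓐⁻¹`. -/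
def P (x : N) (a b : Fin m) : ℝ := (D.A x)⁻¹ (Sum.inl a) (Sum.inl b)

/-- The vector field `n`: the off-diagonal block of `𝓐⁻¹`. -/
def n : VField m N := fun x ↦ ∑ a, (D.A x)⁻¹ (Sum.inl a) (Sum.inr ()) • e x a

/-- The trace `tr_P T = P^{ab} T_{ab}`. -/
def trP (T : Tensor2 m N) (x : N) : ℝ := ∑ a, ∑ b, D.P x a b * T x (e x a) (e x b)

lemma A_mul_inv (x : N) : D.A x * (D.A x)⁻¹ = 1 := Matrix.mul_nonsing_inv _ (D.nondegenerate x)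

lemma A_inv_mul (x : N) : (D.A x)⁻¹ * D.A x = 1 := Matrix.nonsing_inv_mul _ (D.nondegenerate x)

lemma A_inv_symm (x : N) (i j) : (D.A x)⁻¹ i j = (D.A x)⁻¹ j i := by
  have h : (D.A x).transpose = D.A x := by
    ext i j
    rcases i with a | a <;> rcases j with b | b <;> simp [A]
    exact D.symm_γ x _ _
  have := Matrix.transpose_nonsing_inv (D.A x)
  rw [h] at this
  exact (congr_fun (congr_fun this j) i)

lemma co_n (x : N) (a : Fin m) : co (D.n x) a = (D.A x)⁻¹ (Sum.inl a) (Sum.inr ()) :=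
  co_sum_smul_e x _ a

lemma γ_apply_co (x : N) (v w : TangentSpace (𝓡 m) x) :
    D.γ x v w = ∑ a, co w a * D.γ x v (e x a) := by
  conv_lhs => rw [← sum_co_smul_e w]
  simp

lemma ell_apply_co (x : N) (v : TangentSpace (𝓡 m) x) :
    D.ell x v = ∑ a, co v a * D.ell x (e x a) := by
  conv_lhs => rw [← sum_co_smul_e v]
  simp

lemma A_mulVec (x : N) (v : TangentSpace (𝓡 m) x) (t : ℝ) :
    (D.A x).mulVec (Sum.elim (co v) fun _ ↦ t) =
      Sum.elim (fun a ↦ D.γ x v (e x a) + t * D.ell x (e x a))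
        (fun _ ↦ D.ell x v + t * D.ell2 x) := by
  ext i
  rcases i with a | a
  · simp [A, Matrix.mulVec, dotProduct, mul_comm, D.symm_γ x v, D.γ_apply_co x (e x a) v]
  · simp [A, Matrix.mulVec, dotProduct, mul_comm, D.ell_apply_co x v]

/-- A tangent vector is determined by its contractions with `γ` and `ℓ`. -/
lemma eq_of_γ_of_ell {x : N} {v w : TangentSpace (𝓡 m) x} (h : ∀ z, D.γ x v z = D.γ x w z)
    (h' : D.ell x v = D.ell x w) : v = w := by
  have h1 := D.A_mulVec x v 0
  have h2 := D.A_mulVec x w 0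
  simp only [h, h'] at h1
  rw [← h2] at h1
  have h3 := congr_arg (fun u ↦ ((D.A x)⁻¹).mulVec u) h1
  simp only [Matrix.mulVec_mulVec, A_inv_mul, Matrix.one_mulVec] at h3
  exact ext_of_co fun a ↦ congr_fun h3 (Sum.inl a)

lemma exists_radical (x : N) : ∃ k, (∀ z, D.γ x k z = 0) ∧ D.ell x k = 1 := by
  obtain ⟨⟨k, hk⟩, hk0, -⟩ := finrank_eq_one_iff'.1 (D.radical_γ x)
  have hk1 : ∀ z, D.γ x k z = 0 := fun z ↦ by
    have : D.γ x k = 0 := hk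
    simp [this]
  have hl : D.ell x k ≠ 0 := fun h0 ↦ hk0 <| by
    ext1
    exact D.eq_of_γ_of_ell (by simp [hk1]) (by simp [h0])
  exact ⟨(D.ell x k)⁻¹ • k, by simp [hk1], by simp [hl]⟩

lemma n_aux (x : N) : (∀ z, D.γ x (D.n x) z = 0) ∧ D.ell x (D.n x) = 1 ∧
    (D.A x)⁻¹ (Sum.inr ()) (Sum.inr ()) = 0 := by
  obtain ⟨k, hk, hk'⟩ := D.exists_radical x
  have h1 := D.A_mulVec x k 0
  have h3 := congr_arg (fun u ↦ ((D.A x)⁻¹).mulVec u) h1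
  simp only [Matrix.mulVec_mulVec, A_inv_mul, Matrix.one_mulVec, hk, hk'] at h3
  have h4 : D.n x = k := ext_of_co fun a ↦ by
    have := congr_fun h3 (Sum.inl a)
    simp [Matrix.mulVec, dotProduct] at this
    rw [co_n, this]
  have := congr_fun h3 (Sum.inr ())
  simp [Matrix.mulVec, dotProduct] at this
  exact ⟨h4 ▸ hk, h4 ▸ hk', this.symm⟩

/-- `γ_{ab} n^a = 0`. -/
lemma γ_n (x : N) (z) : D.γ x (D.n x) z = 0 := (D.n_aux x).1 z

/-- `ℓ_a n^a = 1`. -/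
lemma ell_n (x : N) : D.ell x (D.n x) = 1 := (D.n_aux x).2.1

/-- `P^{ab} ℓ_b + ℓ⁽²⁾ n^a = 0`. -/
lemma P_ell (x : N) (a : Fin m) :
    ∑ b, D.P x a b * D.ell x (e x b) + D.ell2 x * co (D.n x) a = 0 := by
  have := congr_fun (congr_fun (D.A_inv_mul x) (Sum.inl a)) (Sum.inr ())
  simp [Matrix.mul_apply, A] at this
  simpa [P, co_n, mul_comm, A] using this

/-- `P^{ab} γ_{bc} + n^a ℓ_c = δ^a_c`. -/
lemma P_γ (x : N) (a c : Fin m) :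
    ∑ b, D.P x a b * D.γ x (e x b) (e x c) + co (D.n x) a * D.ell x (e x c) =
      if a = c then 1 else 0 := by
  have := congr_fun (congr_fun (D.A_inv_mul x) (Sum.inl a)) (Sum.inl c)
  simp [Matrix.mul_apply, A, Matrix.one_apply] at this
  simpa [P, co_n, mul_comm, A] using this

/-- The vector `P^{ab} θ_b + c n^a`. -/
def raise (x : N) (θ : Fin m → ℝ) (c : ℝ) : TangentSpace (𝓡 m) x :=
  ∑ a, (∑ b, D.P x a b * θ b + c * co (D.n x) a) • e x a

lemma P_symm (x : N) (a b : Fin m) : D.P x a b = D.P x b a := D.A_inv_symm x _ _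

lemma γ_raise (x : N) (θ : Fin m → ℝ) (c : ℝ) (z : TangentSpace (𝓡 m) x) :
    D.γ x (D.raise x θ c) z = ∑ b, co z b * θ b - D.ell x z * ∑ b, co (D.n x) b * θ b := by
  suffices h : ∀ d, D.γ x (D.raise x θ c) (e x d) =
      θ d - D.ell x (e x d) * ∑ b, co (D.n x) b * θ b by
    rw [D.γ_apply_co, D.ell_apply_co, Finset.sum_mul, ← Finset.sum_sub_distrib]
    refine Finset.sum_congr rfl fun d _ ↦ ?_
    rw [h]; ring
  intro d
  have hn : ∑ a, co (D.n x) a * D.γ x (e x a) (e x d) = 0 := by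
    rw [← D.γ_n x (e x d), D.symm_γ x (D.n x), D.γ_apply_co x _ (D.n x)]
    simp [D.symm_γ x (e x d)]
  have h1 : D.γ x (D.raise x θ c) (e x d) =
      ∑ b, θ b * ∑ a, D.P x b a * D.γ x (e x a) (e x d) := by
    have h2 : D.γ x (D.raise x θ c) (e x d) = ∑ a, (∑ b, D.P x a b * θ b + c * co (D.n x) a) *
        D.γ x (e x a) (e x d) := by simp [raise]
    simp only [add_mul, Finset.sum_add_distrib, mul_assoc, ← Finset.mul_sum, hn, mul_zero,
      add_zero, Finset.sum_mul] at h2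
    rw [h2, Finset.sum_comm]
    refine Finset.sum_congr rfl fun b _ ↦ ?_
    rw [Finset.mul_sum]
    refine Finset.sum_congr rfl fun a _ ↦ ?_
    rw [D.P_symm x a b]; ring
  have h3 : ∀ b, ∑ a, D.P x b a * D.γ x (e x a) (e x d) =
      (if b = d then 1 else 0) - co (D.n x) b * D.ell x (e x d) := fun b ↦ by
    rw [← D.P_γ x b d]; ring
  simp only [h1, h3, mul_sub, Finset.sum_sub_distrib, mul_ite, mul_one, mul_zero,
    Finset.sum_ite_eq', Finset.mem_univ, if_true, Finset.mul_sum]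
  congr 1
  refine Finset.sum_congr rfl fun b _ ↦ ?_
  ring

lemma ell_raise (x : N) (θ : Fin m → ℝ) (c : ℝ) :
    D.ell x (D.raise x θ c) = c - D.ell2 x * ∑ b, co (D.n x) b * θ b := by
  have hn : ∑ a, co (D.n x) a * D.ell x (e x a) = 1 := by
    rw [← D.ell_n x, D.ell_apply_co x (D.n x)]
  have h2 : D.ell x (D.raise x θ c) = ∑ a, (∑ b, D.P x a b * θ b + c * co (D.n x) a) *
        D.ell x (e x a) := by simp [raise]
  have h3 : ∀ b, ∑ a, D.P x b a * D.ell x (e x a) = - (D.ell2 x * co (D.n x) b) := fun b ↦ by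
    rw [← add_eq_zero_iff_eq_neg, D.P_ell x b]
  simp only [add_mul, Finset.sum_add_distrib, mul_assoc, ← Finset.mul_sum, hn, mul_one,
      Finset.sum_mul] at h2
  rw [h2, Finset.sum_comm]
  have h4 : ∀ b, ∑ a, D.P x a b * (θ b * D.ell x (e x a)) = θ b * ∑ a, D.P x b a * D.ell x (e x a) := by
    intro b
    rw [Finset.mul_sum]
    refine Finset.sum_congr rfl fun a _ ↦ ?_
    rw [D.P_symm x a b]; ring
  simp only [h4, h3]
  rw [Finset.mul_sum, add_comm, sub_eq_add_neg, ← Finset.sum_neg_distrib]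
  congr 1
  refine Finset.sum_congr rfl fun b _ ↦ ?_
  ring

end NullMetricData
section Smoothness

variable {m : ℕ} {N : Type*} [TopologicalSpace N] [ChartedSpace (EuclideanSpace ℝ (Fin m)) N]

lemma contMDiffAt_det {ι : Type*} [Fintype ι] [DecidableEq ι] {B : N → Matrix ι ι ℝ} {x : N}
    (hB : ∀ i j, ContMDiffAt (𝓡 m) 𝓘(ℝ, ℝ) ∞ (fun y ↦ B y i j) x) :
    ContMDiffAt (𝓡 m) 𝓘(ℝ, ℝ) ∞ (fun y ↦ (B y).det) x := by
  simp only [Matrix.det_apply, Units.smul_def, zsmul_eq_mul]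
  refine ContMDiffAt.sum fun σ _ ↦ ContMDiffAt.mul contMDiffAt_const ?_
  exact contMDiffAt_finsetProd fun i _ ↦ hB _ _

lemma contMDiffAt_inv {ι : Type*} [Fintype ι] [DecidableEq ι] {B : N → Matrix ι ι ℝ} {x : N}
    (hB : ∀ i j, ContMDiffAt (𝓡 m) 𝓘(ℝ, ℝ) ∞ (fun y ↦ B y i j) x) (hx : (B x).det ≠ 0) (i j : ι) :
    ContMDiffAt (𝓡 m) 𝓘(ℝ, ℝ) ∞ (fun y ↦ (B y)⁻¹ i j) x := by
  simp only [Matrix.inv_def, Matrix.smul_apply, Ring.inverse_eq_inv', smul_eq_mul,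
    Matrix.adjugate_apply]
  refine ContMDiffAt.mul ((contMDiffAt_det hB).inv₀ hx) (contMDiffAt_det fun k l ↦ ?_)
  by_cases h : k = j
  · subst h; simpa using contMDiffAt_const
  · simpa [Matrix.updateRow_ne h] using hB k l

variable [IsManifold (𝓡 m) ∞ N]

lemma SmoothTensor2.contMDiffAt
    {T : Π x : N, TangentSpace (𝓡 m) x →L[ℝ] TangentSpace (𝓡 m) x →L[ℝ] ℝ}
    (hT : SmoothTensor2 m N T) {V W : VField m N} {x : N}
    (hV : ContMDiffAt (𝓡 m) ((𝓡 m).prod 𝓘(ℝ, EuclideanSpace ℝ (Fin m))) ∞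
      (fun y ↦ TotalSpace.mk' (EuclideanSpace ℝ (Fin m)) y (V y)) x)
    (hW : ContMDiffAt (𝓡 m) ((𝓡 m).prod 𝓘(ℝ, EuclideanSpace ℝ (Fin m))) ∞
      (fun y ↦ TotalSpace.mk' (EuclideanSpace ℝ (Fin m)) y (W y)) x) :
    ContMDiffAt (𝓡 m) 𝓘(ℝ, ℝ) ∞ (fun y ↦ T y (V y) (W y)) x := by
  have : ContMDiffAt (𝓡 m) ((𝓡 m).prod 𝓘(ℝ)) ∞
      (fun y ↦ TotalSpace.mk' ℝ (E := Bundle.Trivial N ℝ) y (T y (V y) (W y))) x :=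
    ContMDiffAt.clm_bundle_apply₂ (b := fun y ↦ y) (F₁ := EuclideanSpace ℝ (Fin m))
      (F₂ := EuclideanSpace ℝ (Fin m)) (hT x) hV hW
  simp only [contMDiffAt_totalSpace] at this
  exact this.2

lemma SmoothForm1.contMDiffAt {θ : Π x : N, TangentSpace (𝓡 m) x →L[ℝ] ℝ}
    (hθ : SmoothForm1 m N θ) {V : VField m N} {x : N}
    (hV : ContMDiffAt (𝓡 m) ((𝓡 m).prod 𝓘(ℝ, EuclideanSpace ℝ (Fin m))) ∞
      (fun y ↦ TotalSpace.mk' (EuclideanSpace ℝ (Fin m)) y (V y)) x) :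
    ContMDiffAt (𝓡 m) 𝓘(ℝ, ℝ) ∞ (fun y ↦ θ y (V y)) x := by
  have : ContMDiffAt (𝓡 m) ((𝓡 m).prod 𝓘(ℝ)) ∞
      (fun y ↦ TotalSpace.mk' ℝ (E := Bundle.Trivial N ℝ) y (θ y (V y))) x :=
    ContMDiffAt.clm_bundle_apply (b := fun y ↦ y) (F₁ := EuclideanSpace ℝ (Fin m)) (hθ x) hV
  simp only [contMDiffAt_totalSpace] at this
  exact this.2

lemma SmoothTensor2.mdifferentiableAt
    {T : Π x : N, TangentSpace (𝓡 m) x →L[ℝ] TangentSpace (𝓡 m) x →L[ℝ] ℝ}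
    (hT : SmoothTensor2 m N T) {V W : VField m N} {x : N} (hV : DiffVF V x) (hW : DiffVF W x) :
    MDifferentiableAt (𝓡 m) 𝓘(ℝ, ℝ) (fun y ↦ T y (V y) (W y)) x := by
  have : MDifferentiableAt (𝓡 m) ((𝓡 m).prod 𝓘(ℝ))
      (fun y ↦ TotalSpace.mk' ℝ (E := Bundle.Trivial N ℝ) y (T y (V y) (W y))) x :=
    MDifferentiableAt.clm_bundle_apply₂ (b := fun y ↦ y) (F₁ := EuclideanSpace ℝ (Fin m))
      (F₂ := EuclideanSpace ℝ (Fin m)) ((hT x).mdifferentiableAt (by simp)) hV hW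
  simp only [mdifferentiableAt_totalSpace] at this
  exact this.2

lemma SmoothForm1.mdifferentiableAt {θ : Π x : N, TangentSpace (𝓡 m) x →L[ℝ] ℝ}
    (hθ : SmoothForm1 m N θ) {V : VField m N} {x : N} (hV : DiffVF V x) :
    MDifferentiableAt (𝓡 m) 𝓘(ℝ, ℝ) (fun y ↦ θ y (V y)) x := by
  have : MDifferentiableAt (𝓡 m) ((𝓡 m).prod 𝓘(ℝ))
      (fun y ↦ TotalSpace.mk' ℝ (E := Bundle.Trivial N ℝ) y (θ y (V y))) x :=
    MDifferentiableAt.clm_bundle_apply (b := fun y ↦ y) (F₁ := EuclideanSpace ℝ (Fin m))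
      ((hθ x).mdifferentiableAt (by simp)) hV
  simp only [mdifferentiableAt_totalSpace] at this
  exact this.2

lemma diffVF_ext {x : N} (v : TangentSpace (𝓡 m) x) : DiffVF (ext v) x :=
  mdifferentiableAt_extend (𝓡 m) (EuclideanSpace ℝ (Fin m)) v

lemma ext_self {x : N} (v : TangentSpace (𝓡 m) x) : ext v x = v := by simp [ext]

lemma DiffVF.add {V W : VField m N} {x : N} (hV : DiffVF V x) (hW : DiffVF W x) :
    DiffVF (V + W) x :=
  mdifferentiableAt_add_section hV hW

lemma DiffVF.smul {f : N → ℝ} {V : VField m N} {x : N} (hf : MDifferentiableAt (𝓡 m) 𝓘(ℝ, ℝ) f x)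
    (hV : DiffVF V x) : DiffVF (f • V) x :=
  MDifferentiableAt.smul_section hf hV

namespace NullMetricData

variable (D : NullMetricData m N)

/-- A vector field is smooth if its contractions with `γ` and `ℓ` are smooth. -/
lemma contMDiffAt_of_lower {V : VField m N} {x : N}
    (h : ∀ W : VField m N, ContMDiffAt (𝓡 m) ((𝓡 m).prod 𝓘(ℝ, EuclideanSpace ℝ (Fin m))) ∞
        (fun y ↦ TotalSpace.mk' (EuclideanSpace ℝ (Fin m)) y (W y)) x →
      ContMDiffAt (𝓡 m) 𝓘(ℝ, ℝ) ∞ (fun y ↦ D.γ y (V y) (W y)) x)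
    (h' : ContMDiffAt (𝓡 m) 𝓘(ℝ, ℝ) ∞ (fun y ↦ D.ell y (V y)) x) :
    ContMDiffAt (𝓡 m) ((𝓡 m).prod 𝓘(ℝ, EuclideanSpace ℝ (Fin m))) ∞
      (fun y ↦ TotalSpace.mk' (EuclideanSpace ℝ (Fin m)) y (V y)) x := by
  set t := trivializationAt (EuclideanSpace ℝ (Fin m)) (TangentSpace (𝓡 m) : N → Type _) x
  set b := (EuclideanSpace.basisFun (Fin m) ℝ).toBasis
  have hx : x ∈ t.baseSet := FiberBundle.mem_baseSet_trivializationAt' x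
  set f : Fin m → VField m N := t.localFrame b with hf
  have hfs : ∀ a, ContMDiffAt (𝓡 m) ((𝓡 m).prod 𝓘(ℝ, EuclideanSpace ℝ (Fin m))) ∞
      (fun y ↦ TotalSpace.mk' (EuclideanSpace ℝ (Fin m)) y (f a y)) x :=
    fun a ↦ contMDiffAt_localFrame_of_mem (n := ∞) t b a hx
  set B : N → Matrix (Fin m ⊕ Unit) (Fin m ⊕ Unit) ℝ := fun y ↦ Matrix.fromBlocks
    (Matrix.of fun a b ↦ D.γ y (f a y) (f b y)) (Matrix.of fun a (_ : Unit) ↦ D.ell y (f a y))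
    (Matrix.of fun (_ : Unit) b ↦ D.ell y (f b y))
    (Matrix.of fun (_ : Unit) (_ : Unit) ↦ D.ell2 y) with hB
  have hBs : ∀ i j, ContMDiffAt (𝓡 m) 𝓘(ℝ, ℝ) ∞ (fun y ↦ B y i j) x := by
    rintro (a | a) (c | c)
    · simpa [hB] using D.smooth_γ.contMDiffAt (hfs a) (hfs c)
    · simpa [hB] using D.smooth_ell.contMDiffAt (hfs a)
    · simpa [hB] using D.smooth_ell.contMDiffAt (hfs c)
    · simpa [hB] using D.smooth_ell2 x
  have hBv : ∀ y ∈ t.baseSet, ∀ (c : Fin m → ℝ) (s : ℝ),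
      (B y).mulVec (Sum.elim c fun _ ↦ s) =
      Sum.elim (fun a ↦ D.γ y (∑ d, c d • f d y) (f a y) + s * D.ell y (f a y))
        (fun _ ↦ D.ell y (∑ d, c d • f d y) + s * D.ell2 y) := by
    intro y hy c s
    ext i
    rcases i with a | a
    · simp [hB, Matrix.mulVec, dotProduct, mul_comm, D.symm_γ y (f a y)]
    · simp [hB, Matrix.mulVec, dotProduct, mul_comm]
  have hdet : ∀ y ∈ t.baseSet, (B y).det ≠ 0 := by
    intro y hy h0
    obtain ⟨u, hu0, hu⟩ := Matrix.exists_mulVec_eq_zero_iff.2 h0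
    have hu' : u = Sum.elim (fun a ↦ u (Sum.inl a)) fun _ ↦ u (Sum.inr ()) := by
      ext i; rcases i with a | a <;> rfl
    set c : Fin m → ℝ := fun a ↦ u (Sum.inl a)
    set s : ℝ := u (Sum.inr ())
    rw [hu', hBv y hy] at hu
    set v := ∑ d, c d • f d y with hv
    have h1 : ∀ a, D.γ y v (f a y) + s * D.ell y (f a y) = 0 := fun a ↦
      congr_fun hu (Sum.inl a)
    have h2 : D.ell y v + s * D.ell2 y = 0 := congr_fun hu (Sum.inr ())
    have hspan : ∀ z : TangentSpace (𝓡 m) y, D.γ y v z + s * D.ell y z = 0 := by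
      intro z
      have hz : z = ∑ a, (t.basisAt b hy).repr z a • f a y := by
        conv_lhs => rw [← (t.basisAt b hy).sum_repr z]
        refine Finset.sum_congr rfl fun a _ ↦ ?_
        rw [hf, t.localFrame_apply_of_mem_baseSet b hy]
      rw [hz]
      simp only [map_sum, map_smul, smul_eq_mul, Finset.mul_sum, ← Finset.sum_add_distrib]
      refine Finset.sum_eq_zero fun a _ ↦ ?_
      linear_combination (t.basisAt b hy).repr z a * h1 a
    have hs : s = 0 := by
      have := hspan (D.n y)
      rwa [D.symm_γ, D.γ_n, D.ell_n, zero_add, mul_one] at this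
    have hv0 : v = 0 := D.eq_of_γ_of_ell (fun z ↦ by simpa [hs] using hspan z)
      (by simpa [hs] using h2)
    have hli : LinearIndependent ℝ fun a ↦ f a y := by
      have := (t.basisAt b hy).linearIndependent
      convert! this using 2 with a
      simp [hf, hy]
    have hc := Fintype.linearIndependent_iff.1 hli c (hv ▸ hv0)
    apply hu0
    rw [hu']
    ext i
    rcases i with a | a
    · exact hc a
    · exact hs
  refine (contMDiffAt_iff_localFrameCoeff (I := 𝓡 m) (k := ∞) (e := t) b hx).2 fun a ↦ ?_
  have hkey : ∀ y ∈ t.baseSet, t.localFrameCoeff (𝓡 m) b a y (V y) =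
      ∑ d, (B y)⁻¹ (Sum.inl a) (Sum.inl d) * D.γ y (V y) (f d y) +
        (B y)⁻¹ (Sum.inl a) (Sum.inr ()) * D.ell y (V y) := by
    intro y hy
    have h1 := hBv y hy (fun d ↦ t.localFrameCoeff (𝓡 m) b d y (V y)) 0
    rw [← t.eq_sum_localFrameCoeff_smul (I := 𝓡 m) (b := b) (s := V) hy] at h1
    have h3 := congr_arg (fun u ↦ ((B y)⁻¹).mulVec u) h1
    simp only [Matrix.mulVec_mulVec, Matrix.nonsing_inv_mul _ (isUnit_iff_ne_zero.2 (hdet y hy)),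
      Matrix.one_mulVec] at h3
    have := congr_fun h3 (Sum.inl a)
    simpa [Matrix.mulVec, dotProduct] using this
  have hsm : ContMDiffAt (𝓡 m) 𝓘(ℝ, ℝ) ∞ (fun y ↦
      ∑ d, (B y)⁻¹ (Sum.inl a) (Sum.inl d) * D.γ y (V y) (f d y) +
        (B y)⁻¹ (Sum.inl a) (Sum.inr ()) * D.ell y (V y)) x :=
    (ContMDiffAt.sum fun d _ ↦
      (contMDiffAt_inv hBs (hdet x hx) _ _).mul (h _ (hfs d))).add
      ((contMDiffAt_inv hBs (hdet x hx) _ _).mul h')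
  refine hsm.congr_of_eventuallyEq ?_
  filter_upwards [t.open_baseSet.mem_nhds hx] with y hy using hkey y hy

/-- The vector field `n` is smooth. -/
lemma contMDiffAt_n (x : N) :
    ContMDiffAt (𝓡 m) ((𝓡 m).prod 𝓘(ℝ, EuclideanSpace ℝ (Fin m))) ∞
      (fun y ↦ TotalSpace.mk' (EuclideanSpace ℝ (Fin m)) y (D.n y)) x :=
  D.contMDiffAt_of_lower (fun W _ ↦ by simpa [D.γ_n] using contMDiffAt_const)
    (by simpa [D.ell_n] using contMDiffAt_const)

lemma diffVF_n (x : N) : DiffVF D.n x := (D.contMDiffAt_n x).mdifferentiableAt (by simp)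

end NullMetricData

end Smoothness
/-! ### Lie derivatives, exterior derivative, covariant derivatives -/

section Calculus

variable {m : ℕ} {N : Type*} [TopologicalSpace N] [ChartedSpace (EuclideanSpace ℝ (Fin m)) N]

/-- The derivative `v(f)` of a function along a tangent vector. -/
def dir (f : N → ℝ) (x : N) (v : TangentSpace (𝓡 m) x) : ℝ := mvfderiv (𝓡 m) f x v

/-- The symmetrization `T_{(ab)}`. -/
def symm (T : Tensor2 m N) : Tensor2 m N := fun x v w ↦ (1 / 2) * (T x v w + T x w v)

lemma dir_add {f g : N → ℝ} {x : N} (hf : MDifferentiableAt (𝓡 m) 𝓘(ℝ, ℝ) f x)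
    (hg : MDifferentiableAt (𝓡 m) 𝓘(ℝ, ℝ) g x) (v : TangentSpace (𝓡 m) x) :
    dir (fun y ↦ f y + g y) x v = dir f x v + dir g x v := by
  simp [dir, mvfderiv_fun_add hf hg]

lemma dir_mul {f g : N → ℝ} {x : N} (hf : MDifferentiableAt (𝓡 m) 𝓘(ℝ, ℝ) f x)
    (hg : MDifferentiableAt (𝓡 m) 𝓘(ℝ, ℝ) g x) (v : TangentSpace (𝓡 m) x) :
    dir (fun y ↦ f y * g y) x v = f x * dir g x v + g x * dir f x v := by
  simp [dir, mvfderiv_fun_mul hf hg]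

lemma dir_const (c : ℝ) (x : N) (v : TangentSpace (𝓡 m) x) :
    dir (fun _ : N ↦ c) x v = 0 := by
  simp [dir, mvfderiv_const]

lemma dir_vadd (f : N → ℝ) (x : N) (v w : TangentSpace (𝓡 m) x) :
    dir f x (v + w) = dir f x v + dir f x w := by simp [dir]

lemma dir_vsmul (f : N → ℝ) (x : N) (c : ℝ) (v : TangentSpace (𝓡 m) x) :
    dir f x (c • v) = c * dir f x v := by simp [dir]

variable [IsManifold (𝓡 m) ∞ N]

/-- The Lie derivative of a `(0,2)`-tensor field:
`(£_Z T)(V, W) = Z(T(V, W)) - T([Z, V], W) - T(V, [Z, W])`. -/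
def lieDeriv (Z : VField m N) (T : Tensor2 m N) : Tensor2 m N := fun x v w ↦
  dir (fun y ↦ T y (ext v y) (ext w y)) x (Z x)
    - T x (mlieBracket (𝓡 m) Z (ext v) x) w - T x v (mlieBracket (𝓡 m) Z (ext w) x)

/-- The exterior derivative of a covector field:
`dθ(V, W) = V(θ(W)) - W(θ(V)) - θ([V, W])`. -/
def extDer (θ : Form1 m N) : Tensor2 m N := fun x v w ↦
  dir (fun y ↦ θ y (ext w y)) x v - dir (fun y ↦ θ y (ext v y)) x w
    - θ x (mlieBracket (𝓡 m) (ext v) (ext w) x)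

/-- `(∇_u θ)(w) = u(θ(W)) - θ(∇_u W)`, i.e. `∇_a θ_b` contracted with `u^a w^b`. -/
def covForm (nab : CovariantDerivative (𝓡 m) (EuclideanSpace ℝ (Fin m))
    (TangentSpace (𝓡 m) : N → Type _)) (θ : Form1 m N) : Tensor2 m N := fun x u w ↦
  dir (fun y ↦ θ y (ext w y)) x u - θ x (nab (ext w) x u)

/-- `(∇_u T)(v, w) = u(T(V, W)) - T(∇_u V, W) - T(V, ∇_u W)`, i.e. `∇_a T_{bc}` contracted with
`u^a v^b w^c`. -/
def covTensor (nab : CovariantDerivative (𝓡 m) (EuclideanSpace ℝ (Fin m))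
    (TangentSpace (𝓡 m) : N → Type _)) (T : Tensor2 m N) (x : N)
    (u v w : TangentSpace (𝓡 m) x) : ℝ :=
  dir (fun y ↦ T y (ext v y) (ext w y)) x u - T x (nab (ext v) x u) w - T x v (nab (ext w) x u)

/-- The curvature `R(X, W) Z = ∇_X ∇_W Z - ∇_W ∇_X Z - ∇_{[X, W]} Z`. -/
def curvature (nab : CovariantDerivative (𝓡 m) (EuclideanSpace ℝ (Fin m))
    (TangentSpace (𝓡 m) : N → Type _)) (x : N) (u w z : TangentSpace (𝓡 m) x) :
    TangentSpace (𝓡 m) x :=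
  nab (fun y ↦ nab (ext z) y (ext w y)) x u - nab (fun y ↦ nab (ext z) y (ext u y)) x w
    - nab (ext z) x (mlieBracket (𝓡 m) (ext u) (ext w) x)

/-- The Ricci tensor `R_{bd} = R^a_{bad}`, i.e. `Ric(z, w)` is the trace of `u ↦ R(u, w) z`. -/
def ricci (nab : CovariantDerivative (𝓡 m) (EuclideanSpace ℝ (Fin m))
    (TangentSpace (𝓡 m) : N → Type _)) : Tensor2 m N := fun x z w ↦
  ∑ a, co (curvature nab x (e x a) w z) a

/-- The Lie derivative of a connection along `Z`:
`(£_Z ∇)(X, W) = £_Z (∇_X W) - ∇_X (£_Z W) - ∇_{£_Z X} W`. -/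
def lieConnection (Z : VField m N) (nab : CovariantDerivative (𝓡 m) (EuclideanSpace ℝ (Fin m))
    (TangentSpace (𝓡 m) : N → Type _)) (x : N) (v w : TangentSpace (𝓡 m) x) :
    TangentSpace (𝓡 m) x :=
  mlieBracket (𝓡 m) Z (fun y ↦ nab (ext w) y (ext v y)) x
    - nab (mlieBracket (𝓡 m) Z (ext w)) x v
    - nab (ext w) x (mlieBracket (𝓡 m) Z (ext v) x)

/-! Tensoriality of the Lie and exterior derivatives. -/

lemma br_add_left {V V' : VField m N} {x : N} (W : VField m N) (hV : DiffVF V x)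
    (hV' : DiffVF V' x) : mlieBracket (𝓡 m) (V + V') W x =
      mlieBracket (𝓡 m) V W x + mlieBracket (𝓡 m) V' W x :=
  mlieBracket_add_left hV hV'

lemma br_add_right {V V' : VField m N} {x : N} (W : VField m N) (hV : DiffVF V x)
    (hV' : DiffVF V' x) : mlieBracket (𝓡 m) W (V + V') x =
      mlieBracket (𝓡 m) W V x + mlieBracket (𝓡 m) W V' x :=
  mlieBracket_add_right hV hV'

lemma br_smul_left {f : N → ℝ} {V : VField m N} {x : N} (W : VField m N)
    (hf : MDifferentiableAt (𝓡 m) 𝓘(ℝ, ℝ) f x) (hV : DiffVF V x) :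
    mlieBracket (𝓡 m) (f • V) W x = -dir f x (W x) • V x + f x • mlieBracket (𝓡 m) V W x :=
  mlieBracket_smul_left hf hV

lemma br_smul_right {f : N → ℝ} {V : VField m N} {x : N} (W : VField m N)
    (hf : MDifferentiableAt (𝓡 m) 𝓘(ℝ, ℝ) f x) (hV : DiffVF V x) :
    mlieBracket (𝓡 m) W (f • V) x = dir f x (W x) • V x + f x • mlieBracket (𝓡 m) W V x :=
  mlieBracket_smul_right hf hV

section Lie

variable {T : Π x : N, TangentSpace (𝓡 m) x →L[ℝ] TangentSpace (𝓡 m) x →L[ℝ] ℝ}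

/-- The defining expression of the Lie derivative, on vector fields. -/
def lieAux (Z : VField m N)
    (T : Π x : N, TangentSpace (𝓡 m) x →L[ℝ] TangentSpace (𝓡 m) x →L[ℝ] ℝ) (x : N)
    (V W : VField m N) : ℝ :=
  dir (fun y ↦ T y (V y) (W y)) x (Z x)
    - T x (mlieBracket (𝓡 m) Z V x) (W x) - T x (V x) (mlieBracket (𝓡 m) Z W x)

lemma tensorial_lieAux₁ (hT : SmoothTensor2 m N T) (Z : VField m N) (x : N) (W : VField m N)
    (hW : DiffVF W x) :
    TensorialAt (𝓡 m) (EuclideanSpace ℝ (Fin m)) (fun V ↦ lieAux Z T x V W) x where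
  smul {f V} hf hV := by
    simp only [lieAux, br_smul_right Z hf hV, Pi.smul_apply', map_smul, map_add,
      smul_apply, add_apply, smul_eq_mul,
      dir_mul hf (hT.mdifferentiableAt hV hW)]
    ring
  add {V V'} hV hV' := by
    simp only [lieAux, br_add_right Z hV hV', Pi.add_apply, map_add,
      add_apply,
      dir_add (hT.mdifferentiableAt hV hW) (hT.mdifferentiableAt hV' hW)]
    ring

lemma tensorial_lieAux₂ (hT : SmoothTensor2 m N T) (Z : VField m N) (x : N) (V : VField m N)
    (hV : DiffVF V x) :
    TensorialAt (𝓡 m) (EuclideanSpace ℝ (Fin m)) (fun W ↦ lieAux Z T x V W) x where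
  smul {f W} hf hW := by
    simp only [lieAux, br_smul_right Z hf hW, Pi.smul_apply', map_smul, map_add, smul_eq_mul,
      dir_mul hf (hT.mdifferentiableAt hV hW)]
    ring
  add {W W'} hW hW' := by
    simp only [lieAux, br_add_right Z hW hW', Pi.add_apply, map_add,
      dir_add (hT.mdifferentiableAt hV hW) (hT.mdifferentiableAt hV hW')]
    ring

lemma lieDeriv_apply (hT : SmoothTensor2 m N T) (Z : VField m N) {x : N} {V W : VField m N}
    (hV : DiffVF V x) (hW : DiffVF W x) :
    lieDeriv Z (fun x v w ↦ T x v w) x (V x) (W x) =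
      dir (fun y ↦ T y (V y) (W y)) x (Z x)
        - T x (mlieBracket (𝓡 m) Z V x) (W x) - T x (V x) (mlieBracket (𝓡 m) Z W x) := by
  have := TensorialAt.pointwise₂ (Φ := lieAux Z T x) (tensorial_lieAux₁ hT Z x)
    (tensorial_lieAux₂ hT Z x) (diffVF_ext (V x)) hV (diffVF_ext (W x)) hW (ext_self _)
    (ext_self _)
  simp only [lieAux, ext_self] at this
  exact this

lemma exists_lieDeriv (hT : SmoothTensor2 m N T) (Z : VField m N) (x : N) :
    ∃ B : TangentSpace (𝓡 m) x →L[ℝ] TangentSpace (𝓡 m) x →L[ℝ] ℝ,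
      ∀ v w, lieDeriv Z (fun x v w ↦ T x v w) x v w = B v w :=
  ⟨TensorialAt.mkHom₂ (lieAux Z T x) x (tensorial_lieAux₁ hT Z x) (tensorial_lieAux₂ hT Z x),
    fun v w ↦ by
      have := TensorialAt.mkHom₂_apply (Φ := lieAux Z T x) (tensorial_lieAux₁ hT Z x)
        (tensorial_lieAux₂ hT Z x) (diffVF_ext v) (diffVF_ext w)
      simp only [ext_self] at this
      rw [this]
      simp only [lieAux, ext_self]
      rfl⟩

end Lie

section ExtDer

variable {θ : Π x : N, TangentSpace (𝓡 m) x →L[ℝ] ℝ}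

/-- The defining expression of the exterior derivative, on vector fields. -/
def extAux (θ : Π x : N, TangentSpace (𝓡 m) x →L[ℝ] ℝ) (x : N) (V W : VField m N) : ℝ :=
  dir (fun y ↦ θ y (W y)) x (V x) - dir (fun y ↦ θ y (V y)) x (W x)
    - θ x (mlieBracket (𝓡 m) V W x)

lemma tensorial_extAux₁ (hθ : SmoothForm1 m N θ) (x : N) (W : VField m N) :
    TensorialAt (𝓡 m) (EuclideanSpace ℝ (Fin m)) (fun V ↦ extAux θ x V W) x where
  smul {f V} hf hV := by
    simp only [extAux, br_smul_left W hf hV, Pi.smul_apply', map_smul, map_add, smul_eq_mul,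
      dir_mul hf (hθ.mdifferentiableAt hV), dir_vsmul]
    ring
  add {V V'} hV hV' := by
    simp only [extAux, br_add_left W hV hV', Pi.add_apply, map_add, dir_vadd,
      dir_add (hθ.mdifferentiableAt hV) (hθ.mdifferentiableAt hV')]
    ring

lemma tensorial_extAux₂ (hθ : SmoothForm1 m N θ) (x : N) (V : VField m N) :
    TensorialAt (𝓡 m) (EuclideanSpace ℝ (Fin m)) (fun W ↦ extAux θ x V W) x where
  smul {f W} hf hW := by
    simp only [extAux, br_smul_right V hf hW, Pi.smul_apply', map_smul, map_add, smul_eq_mul,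
      dir_mul hf (hθ.mdifferentiableAt hW), dir_vsmul]
    ring
  add {W W'} hW hW' := by
    simp only [extAux, br_add_right V hW hW', Pi.add_apply, map_add, dir_vadd,
      dir_add (hθ.mdifferentiableAt hW) (hθ.mdifferentiableAt hW')]
    ring

lemma extDer_apply (hθ : SmoothForm1 m N θ) {x : N} {V W : VField m N}
    (hV : DiffVF V x) (hW : DiffVF W x) :
    extDer (fun x v ↦ θ x v) x (V x) (W x) =
      dir (fun y ↦ θ y (W y)) x (V x) - dir (fun y ↦ θ y (V y)) x (W x)
        - θ x (mlieBracket (𝓡 m) V W x) := by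
  have := TensorialAt.pointwise₂ (Φ := extAux θ x) (fun W _ ↦ tensorial_extAux₁ hθ x W)
    (fun V _ ↦ tensorial_extAux₂ hθ x V) (diffVF_ext (V x)) hV (diffVF_ext (W x)) hW (ext_self _)
    (ext_self _)
  simp only [extAux, ext_self] at this
  exact this

lemma exists_extDer (hθ : SmoothForm1 m N θ) (x : N) :
    ∃ B : TangentSpace (𝓡 m) x →L[ℝ] TangentSpace (𝓡 m) x →L[ℝ] ℝ,
      ∀ v w, extDer (fun x v ↦ θ x v) x v w = B v w :=
  ⟨TensorialAt.mkHom₂ (extAux θ x) x (fun W _ ↦ tensorial_extAux₁ hθ x W)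
      (fun V _ ↦ tensorial_extAux₂ hθ x V),
    fun v w ↦ by
      have := TensorialAt.mkHom₂_apply (Φ := extAux θ x) (fun W _ ↦ tensorial_extAux₁ hθ x W)
        (fun V _ ↦ tensorial_extAux₂ hθ x V) (diffVF_ext v) (diffVF_ext w)
      simp only [ext_self] at this
      rw [this]
      simp only [extAux, ext_self]
      rfl⟩

end ExtDer

end Calculus
/-! ### The metric hypersurface connection -/

namespace NullMetricData

variable {m : ℕ} {N : Type*} [TopologicalSpace N] [ChartedSpace (EuclideanSpace ℝ (Fin m)) N]
  [IsManifold (𝓡 m) ∞ N] (D : NullMetricData m N)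

/-- `γ` as a field of functions of two tangent vectors. -/
def γ₂ : Tensor2 m N := fun x v w ↦ D.γ x v w

/-- `ℓ` as a field of functions of one tangent vector. -/
def ell₁ : Form1 m N := fun x v ↦ D.ell x v

/-- `U = ½ £_n γ`. -/
def U : Tensor2 m N := fun x v w ↦ (1 / 2) * lieDeriv D.n D.γ₂ x v w

/-- `F = ½ dℓ`. -/
def F : Tensor2 m N := fun x v w ↦ (1 / 2) * extDer D.ell₁ x v w

/-- `s = F(n, ·)`. -/
def s : Form1 m N := fun x v ↦ D.F x (D.n x) v

/-- The metric hypersurface connection of null metric data: the torsion-free covariant derivative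
with `∇_a γ_{bc} = - ℓ_b U_{ac} - ℓ_c U_{ab}` and `∇_a ℓ_b = F_{ab} - ℓ⁽²⁾ U_{ab}`. -/
structure IsMetricHypersurfaceConnection (nab : CovariantDerivative (𝓡 m)
    (EuclideanSpace ℝ (Fin m)) (TangentSpace (𝓡 m) : N → Type _)) : Prop where
  torsion_eq_zero : nab.torsion = 0
  nabla_γ : ∀ x u v w, covTensor nab D.γ₂ x u v w =
    - D.ell x v * D.U x u w - D.ell x w * D.U x u v
  nabla_ell : ∀ x u v, covForm nab D.ell₁ x u v = D.F x u v - D.ell2 x * D.U x u v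

variable {D} in
lemma mdiff_γ {V W : VField m N} {x : N} (hV : DiffVF V x) (hW : DiffVF W x) :
    MDifferentiableAt (𝓡 m) 𝓘(ℝ, ℝ) (fun y ↦ D.γ y (V y) (W y)) x :=
  D.smooth_γ.mdifferentiableAt hV hW

variable {D} in
lemma mdiff_ell {V : VField m N} {x : N} (hV : DiffVF V x) :
    MDifferentiableAt (𝓡 m) 𝓘(ℝ, ℝ) (fun y ↦ D.ell y (V y)) x :=
  D.smooth_ell.mdifferentiableAt hV

lemma U_apply {x : N} {V W : VField m N} (hV : DiffVF V x) (hW : DiffVF W x) :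
    D.U x (V x) (W x) = (1 / 2) * (dir (fun y ↦ D.γ y (V y) (W y)) x (D.n x)
        - D.γ x (mlieBracket (𝓡 m) D.n V x) (W x)
        - D.γ x (V x) (mlieBracket (𝓡 m) D.n W x)) := by
  rw [← lieDeriv_apply D.smooth_γ D.n hV hW]
  rfl

lemma F_apply {x : N} {V W : VField m N} (hV : DiffVF V x) (hW : DiffVF W x) :
    D.F x (V x) (W x) = (1 / 2) * (dir (fun y ↦ D.ell y (W y)) x (V x)
        - dir (fun y ↦ D.ell y (V y)) x (W x) - D.ell x (mlieBracket (𝓡 m) V W x)) := by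
  rw [← extDer_apply D.smooth_ell hV hW]
  rfl

lemma U_add_left (x : N) (v v' w) : D.U x (v + v') w = D.U x v w + D.U x v' w := by
  obtain ⟨B, hB⟩ := exists_lieDeriv D.smooth_γ D.n x
  change (1 / 2) * lieDeriv D.n (fun x v w ↦ D.γ x v w) x _ _ = (1 / 2) * lieDeriv D.n
    (fun x v w ↦ D.γ x v w) x _ _ + (1 / 2) * lieDeriv D.n (fun x v w ↦ D.γ x v w) x _ _
  simp only [hB, map_add, add_apply]; ring

lemma U_smul_left (x : N) (c : ℝ) (v w) : D.U x (c • v) w = c * D.U x v w := by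
  obtain ⟨B, hB⟩ := exists_lieDeriv D.smooth_γ D.n x
  change (1 / 2) * lieDeriv D.n (fun x v w ↦ D.γ x v w) x _ _ = c * ((1 / 2) * lieDeriv D.n
    (fun x v w ↦ D.γ x v w) x _ _)
  simp only [hB, map_smul, smul_apply, smul_eq_mul]; ring

lemma U_symm (x : N) (v w) : D.U x v w = D.U x w v := by
  have h1 := D.U_apply (diffVF_ext v) (diffVF_ext w)
  have h2 := D.U_apply (diffVF_ext w) (diffVF_ext v)
  simp only [ext_self] at h1 h2
  rw [h1, h2]
  simp only [D.symm_γ _ (ext w _), D.symm_γ x w, D.symm_γ x _ v]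
  ring

lemma U_add_right (x : N) (v w w') : D.U x v (w + w') = D.U x v w + D.U x v w' := by
  simp only [D.U_symm x v, U_add_left]

lemma U_smul_right (x : N) (c : ℝ) (v w) : D.U x v (c • w) = c * D.U x v w := by
  simp only [D.U_symm x v, U_smul_left]

lemma F_antisymm (x : N) (v w) : D.F x v w = - D.F x w v := by
  have h1 := D.F_apply (diffVF_ext v) (diffVF_ext w)
  have h2 := D.F_apply (diffVF_ext w) (diffVF_ext v)
  simp only [ext_self] at h1 h2
  rw [h1, h2, mlieBracket_swap_apply, map_neg]
  ring

lemma F_add_left (x : N) (v v' w) : D.F x (v + v') w = D.F x v w + D.F x v' w := by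
  obtain ⟨B, hB⟩ := exists_extDer D.smooth_ell x
  change (1 / 2) * extDer (fun x v ↦ D.ell x v) x _ _ = (1 / 2) * extDer
    (fun x v ↦ D.ell x v) x _ _ + (1 / 2) * extDer (fun x v ↦ D.ell x v) x _ _
  simp only [hB, map_add, add_apply]; ring

lemma F_smul_left (x : N) (c : ℝ) (v w) : D.F x (c • v) w = c * D.F x v w := by
  obtain ⟨B, hB⟩ := exists_extDer D.smooth_ell x
  change (1 / 2) * extDer (fun x v ↦ D.ell x v) x _ _ = c * ((1 / 2) * extDer
    (fun x v ↦ D.ell x v) x _ _)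
  simp only [hB, map_smul, smul_apply, smul_eq_mul]; ring

lemma F_add_right (x : N) (v w w') : D.F x v (w + w') = D.F x v w + D.F x v w' := by
  simp only [D.F_antisymm x v, F_add_left]; ring

lemma F_smul_right (x : N) (c : ℝ) (v w) : D.F x v (c • w) = c * D.F x v w := by
  simp only [D.F_antisymm x v, F_smul_left]; ring

/-- The Koszul-type expression of `γ(∇_V W, Z)`. -/
def koszul (x : N) (V W Z : VField m N) : ℝ :=
  (1 / 2) * (dir (fun y ↦ D.γ y (W y) (Z y)) x (V x) + dir (fun y ↦ D.γ y (Z y) (V y)) x (W x)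
    - dir (fun y ↦ D.γ y (V y) (W y)) x (Z x) + D.γ x (mlieBracket (𝓡 m) V W x) (Z x)
    - D.γ x (mlieBracket (𝓡 m) W Z x) (V x) + D.γ x (mlieBracket (𝓡 m) Z V x) (W x))
    + D.ell x (Z x) * D.U x (V x) (W x)

/-- The expression of `ℓ(∇_V W)`. -/
def ellPart (x : N) (V W : VField m N) : ℝ :=
  dir (fun y ↦ D.ell y (W y)) x (V x) - D.F x (V x) (W x) + D.ell2 x * D.U x (V x) (W x)

lemma tensorial_koszul₁ (x : N) {W Z : VField m N} (hW : DiffVF W x) (hZ : DiffVF Z x) :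
    TensorialAt (𝓡 m) (EuclideanSpace ℝ (Fin m)) (fun V ↦ D.koszul x V W Z) x where
  smul {f V} hf hV := by
    have h1 : dir (fun y ↦ f y * D.γ y (Z y) (V y)) x (W x) =
        f x * dir (fun y ↦ D.γ y (Z y) (V y)) x (W x) + D.γ x (Z x) (V x) * dir f x (W x) :=
      dir_mul hf (mdiff_γ hZ hV) _
    have h2 : dir (fun y ↦ f y * D.γ y (V y) (W y)) x (Z x) =
        f x * dir (fun y ↦ D.γ y (V y) (W y)) x (Z x) + D.γ x (V x) (W x) * dir f x (Z x) :=
      dir_mul hf (mdiff_γ hV hW) _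
    simp only [koszul, h1, h2, br_smul_left W hf hV, br_smul_right Z hf hV, Pi.smul_apply',
      map_smul, map_add, add_apply, smul_apply, smul_eq_mul, dir_vsmul, U_smul_left,
      D.symm_γ x (Z x) (V x)]
    ring
  add {V V'} hV hV' := by
    have h1 : dir (fun y ↦ D.γ y (Z y) (V y) + D.γ y (Z y) (V' y)) x (W x) =
        dir (fun y ↦ D.γ y (Z y) (V y)) x (W x) + dir (fun y ↦ D.γ y (Z y) (V' y)) x (W x) :=
      dir_add (mdiff_γ hZ hV) (mdiff_γ hZ hV') _
    have h2 : dir (fun y ↦ D.γ y (V y) (W y) + D.γ y (V' y) (W y)) x (Z x) =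
        dir (fun y ↦ D.γ y (V y) (W y)) x (Z x) + dir (fun y ↦ D.γ y (V' y) (W y)) x (Z x) :=
      dir_add (mdiff_γ hV hW) (mdiff_γ hV' hW) _
    simp only [koszul, h1, h2, br_add_left W hV hV', br_add_right Z hV hV', Pi.add_apply,
      map_add, add_apply, dir_vadd, U_add_left]
    ring

lemma tensorial_koszul₃ (x : N) {V W : VField m N} (hV : DiffVF V x) (hW : DiffVF W x) :
    TensorialAt (𝓡 m) (EuclideanSpace ℝ (Fin m)) (fun Z ↦ D.koszul x V W Z) x where
  smul {f Z} hf hZ := by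
    have h1 : dir (fun y ↦ f y * D.γ y (W y) (Z y)) x (V x) =
        f x * dir (fun y ↦ D.γ y (W y) (Z y)) x (V x) + D.γ x (W x) (Z x) * dir f x (V x) :=
      dir_mul hf (mdiff_γ hW hZ) _
    have h2 : dir (fun y ↦ f y * D.γ y (Z y) (V y)) x (W x) =
        f x * dir (fun y ↦ D.γ y (Z y) (V y)) x (W x) + D.γ x (Z x) (V x) * dir f x (W x) :=
      dir_mul hf (mdiff_γ hZ hV) _
    simp only [koszul, h1, h2, br_smul_left V hf hZ, br_smul_right W hf hZ, Pi.smul_apply',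
      map_smul, map_add, add_apply, smul_apply, smul_eq_mul, dir_vsmul,
      D.symm_γ x (Z x) (W x)]
    ring
  add {Z Z'} hZ hZ' := by
    have h1 : dir (fun y ↦ D.γ y (W y) (Z y) + D.γ y (W y) (Z' y)) x (V x) =
        dir (fun y ↦ D.γ y (W y) (Z y)) x (V x) + dir (fun y ↦ D.γ y (W y) (Z' y)) x (V x) :=
      dir_add (mdiff_γ hW hZ) (mdiff_γ hW hZ') _
    have h2 : dir (fun y ↦ D.γ y (Z y) (V y) + D.γ y (Z' y) (V y)) x (W x) =
        dir (fun y ↦ D.γ y (Z y) (V y)) x (W x) + dir (fun y ↦ D.γ y (Z' y) (V y)) x (W x) :=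
      dir_add (mdiff_γ hZ hV) (mdiff_γ hZ' hV) _
    simp only [koszul, h1, h2, br_add_left V hZ hZ', br_add_right W hZ hZ', Pi.add_apply,
      map_add, add_apply, dir_vadd]
    ring

lemma koszul_add₂ {x : N} {V W W' Z : VField m N} (hV : DiffVF V x) (hW : DiffVF W x)
    (hW' : DiffVF W' x) (hZ : DiffVF Z x) :
    D.koszul x V (W + W') Z = D.koszul x V W Z + D.koszul x V W' Z := by
  have h1 : dir (fun y ↦ D.γ y (W y) (Z y) + D.γ y (W' y) (Z y)) x (V x) =
      dir (fun y ↦ D.γ y (W y) (Z y)) x (V x) + dir (fun y ↦ D.γ y (W' y) (Z y)) x (V x) :=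
    dir_add (mdiff_γ hW hZ) (mdiff_γ hW' hZ) _
  have h2 : dir (fun y ↦ D.γ y (V y) (W y) + D.γ y (V y) (W' y)) x (Z x) =
      dir (fun y ↦ D.γ y (V y) (W y)) x (Z x) + dir (fun y ↦ D.γ y (V y) (W' y)) x (Z x) :=
    dir_add (mdiff_γ hV hW) (mdiff_γ hV hW') _
  simp only [koszul, h1, h2, br_add_left Z hW hW', br_add_right V hW hW', Pi.add_apply,
    map_add, add_apply, dir_vadd, U_add_right]
  ring

lemma koszul_smul₂ {x : N} {f : N → ℝ} {V W Z : VField m N} (hV : DiffVF V x)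
    (hf : MDifferentiableAt (𝓡 m) 𝓘(ℝ, ℝ) f x) (hW : DiffVF W x) (hZ : DiffVF Z x) :
    D.koszul x V (f • W) Z = f x * D.koszul x V W Z + dir f x (V x) * D.γ x (W x) (Z x) := by
  have h1 : dir (fun y ↦ f y * D.γ y (W y) (Z y)) x (V x) =
      f x * dir (fun y ↦ D.γ y (W y) (Z y)) x (V x) + D.γ x (W x) (Z x) * dir f x (V x) :=
    dir_mul hf (mdiff_γ hW hZ) _
  have h2 : dir (fun y ↦ f y * D.γ y (V y) (W y)) x (Z x) =
      f x * dir (fun y ↦ D.γ y (V y) (W y)) x (Z x) + D.γ x (V x) (W x) * dir f x (Z x) :=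
    dir_mul hf (mdiff_γ hV hW) _
  simp only [koszul, h1, h2, br_smul_left Z hf hW, br_smul_right V hf hW, Pi.smul_apply',
    map_smul, map_add, add_apply, smul_apply, smul_eq_mul, dir_vsmul, U_smul_right,
    D.symm_γ x (W x) (V x)]
  ring

lemma koszul_congr {x : N} {V V' W Z Z' : VField m N} (hV : DiffVF V x) (hV' : DiffVF V' x)
    (hW : DiffVF W x) (hZ : DiffVF Z x) (hZ' : DiffVF Z' x) (h : V x = V' x) (h' : Z x = Z' x) :
    D.koszul x V W Z = D.koszul x V' W Z' :=
  ((D.tensorial_koszul₁ x hW hZ).pointwise hV hV' h).trans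
    ((D.tensorial_koszul₃ x hV' hW).pointwise hZ hZ' h')

/-- `∇_V W` at `x`, as the vector with the prescribed contractions with `γ` and `ℓ`. -/
def nablaAux (x : N) (V W : VField m N) : TangentSpace (𝓡 m) x :=
  D.raise x (fun b ↦ D.koszul x V W (ext (e x b))) (D.ellPart x V W)

lemma koszul_n {x : N} {V W : VField m N} (hV : DiffVF V x) (hW : DiffVF W x) :
    D.koszul x V W D.n = 0 := by
  have h1 : (fun y ↦ D.γ y (W y) (D.n y)) = fun _ ↦ 0 := by
    ext y; rw [D.symm_γ, D.γ_n]
  have h2 : (fun y ↦ D.γ y (D.n y) (V y)) = fun _ ↦ 0 := by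
    ext y; rw [D.γ_n]
  rw [koszul, h1, h2, dir_const, dir_const, D.ell_n, D.U_apply hV hW, D.symm_γ x _ (D.n x),
    D.γ_n, mlieBracket_swap_apply (V := W), D.symm_γ x (V x)]
  simp only [map_neg, neg_apply]
  ring

lemma sum_koszul {x : N} {V W Z : VField m N} (hV : DiffVF V x) (hW : DiffVF W x)
    (hZ : DiffVF Z x) : ∑ b, co (Z x) b * D.koszul x V W (ext (e x b)) = D.koszul x V W Z := by
  have h1 := TensorialAt.mkHom_apply (D.tensorial_koszul₃ x hV hW) hZ
  rw [← h1]
  conv_rhs => rw [← sum_co_smul_e (Z x)]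
  simp only [map_sum, map_smul, smul_eq_mul]
  rfl

lemma γ_nablaAux {x : N} {V W Z : VField m N} (hV : DiffVF V x) (hW : DiffVF W x)
    (hZ : DiffVF Z x) : D.γ x (D.nablaAux x V W) (Z x) = D.koszul x V W Z := by
  rw [nablaAux, γ_raise, D.sum_koszul hV hW hZ, D.sum_koszul hV hW (D.diffVF_n x),
    D.koszul_n hV hW]
  ring

lemma ell_nablaAux {x : N} {V W : VField m N} (hV : DiffVF V x) (hW : DiffVF W x) :
    D.ell x (D.nablaAux x V W) = D.ellPart x V W := by
  rw [nablaAux, ell_raise, D.sum_koszul hV hW (D.diffVF_n x), D.koszul_n hV hW]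
  ring

lemma tensorial_nablaAux {x : N} {W : VField m N} (hW : DiffVF W x) :
    TensorialAt (𝓡 m) (EuclideanSpace ℝ (Fin m)) (fun V ↦ D.nablaAux x V W) x where
  smul {f V} hf hV := by
    have hfV : DiffVF (f • V) x := DiffVF.smul hf hV
    refine D.eq_of_γ_of_ell (fun z ↦ ?_) ?_
    · have hz := diffVF_ext z
      have h := (D.tensorial_koszul₁ x hW hz).smul hf hV
      rw [← ext_self z, D.γ_nablaAux hfV hW hz, map_smul, smul_apply, D.γ_nablaAux hV hW hz]
      exact h
    · rw [D.ell_nablaAux hfV hW, map_smul, D.ell_nablaAux hV hW]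
      simp only [ellPart, Pi.smul_apply', dir_vsmul, F_smul_left, U_smul_left, smul_eq_mul]
      ring
  add {V V'} hV hV' := by
    have hVV : DiffVF (V + V') x := DiffVF.add hV hV'
    refine D.eq_of_γ_of_ell (fun z ↦ ?_) ?_
    · have hz := diffVF_ext z
      have h := (D.tensorial_koszul₁ x hW hz).add hV hV'
      rw [← ext_self z, D.γ_nablaAux hVV hW hz, map_add, add_apply, D.γ_nablaAux hV hW hz,
        D.γ_nablaAux hV' hW hz]
      exact h
    · rw [D.ell_nablaAux hVV hW, map_add, D.ell_nablaAux hV hW, D.ell_nablaAux hV' hW]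
      simp only [ellPart, Pi.add_apply, dir_vadd, F_add_left, U_add_left]
      ring

open Classical in
/-- The metric hypersurface connection. -/
def nabla : CovariantDerivative (𝓡 m) (EuclideanSpace ℝ (Fin m))
    (TangentSpace (𝓡 m) : N → Type _) where
  toFun W x := if hW : DiffVF W x then
    TensorialAt.mkHom (fun V ↦ D.nablaAux x V W) x (D.tensorial_nablaAux hW) else 0
  isCovariantDerivativeOnUniv :=
    { add := by
        intro W W' x hW hW' _
        replace hW : DiffVF W x := hW
        replace hW' : DiffVF W' x := hW'
        have hWW : DiffVF (W + W') x := DiffVF.add hW hW'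
        rw [dif_pos hWW, dif_pos hW, dif_pos hW']
        ext1 v
        change D.nablaAux x (ext v) (W + W') = D.nablaAux x (ext v) W + D.nablaAux x (ext v) W'
        have hv := diffVF_ext v
        refine D.eq_of_γ_of_ell (fun z ↦ ?_) ?_
        · have hz := diffVF_ext z
          rw [← ext_self z, D.γ_nablaAux hv hWW hz, map_add, add_apply, D.γ_nablaAux hv hW hz,
            D.γ_nablaAux hv hW' hz, D.koszul_add₂ hv hW hW' hz]
        · rw [D.ell_nablaAux hv hWW, map_add, D.ell_nablaAux hv hW, D.ell_nablaAux hv hW']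
          have h1 : dir (fun y ↦ D.ell y (W y) + D.ell y (W' y)) x (ext v x) =
              dir (fun y ↦ D.ell y (W y)) x (ext v x) +
                dir (fun y ↦ D.ell y (W' y)) x (ext v x) :=
            dir_add (mdiff_ell hW) (mdiff_ell hW') _
          simp only [ellPart, Pi.add_apply, map_add, h1, F_add_right, U_add_right]
          ring
      leibniz := by
        intro W f x hW hf _
        replace hW : DiffVF W x := hW
        have hfW : DiffVF (f • W) x := DiffVF.smul hf hW
        rw [dif_pos hfW, dif_pos hW]
        ext1 v
        change D.nablaAux x (ext v) (f • W) = f x • D.nablaAux x (ext v) W + dir f x v • W x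
        have hv := diffVF_ext v
        refine D.eq_of_γ_of_ell (fun z ↦ ?_) ?_
        · have hz := diffVF_ext z
          rw [← ext_self z, D.γ_nablaAux hv hfW hz, D.koszul_smul₂ hv hf hW hz, map_add,
            map_smul, map_smul, add_apply, smul_apply, smul_apply, D.γ_nablaAux hv hW hz]
          simp [ext_self]
        · rw [D.ell_nablaAux hv hfW, map_add, map_smul, map_smul, D.ell_nablaAux hv hW]
          have h1 : dir (fun y ↦ f y * D.ell y (W y)) x v =
              f x * dir (fun y ↦ D.ell y (W y)) x v + D.ell x (W x) * dir f x v :=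
            dir_mul hf (mdiff_ell hW) _
          simp only [ellPart, Pi.smul_apply', map_smul, smul_eq_mul, ext_self, h1, F_smul_right,
            U_smul_right]
          ring }

lemma nabla_apply {x : N} {V W : VField m N} (hV : DiffVF V x) (hW : DiffVF W x) :
    D.nabla W x (V x) = D.nablaAux x V W := by
  have h : D.nabla W x =
      TensorialAt.mkHom (fun V ↦ D.nablaAux x V W) x (D.tensorial_nablaAux hW) := dif_pos hW
  rw [h, TensorialAt.mkHom_apply _ hV]

/-- `D.nabla` satisfies the conditions that characterize the metric hypersurface connection. -/
theorem nabla_spec : D.IsMetricHypersurfaceConnection D.nabla where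
  torsion_eq_zero := by
    rw [CovariantDerivative.torsion_eq_zero_iff]
    intro V W x hV hW
    rw [sub_eq_iff_eq_add, D.nabla_apply hV hW, D.nabla_apply hW hV]
    refine D.eq_of_γ_of_ell (fun z ↦ ?_) ?_
    · have hz := diffVF_ext z
      rw [← ext_self z, map_add, add_apply, D.γ_nablaAux hV hW hz, D.γ_nablaAux hW hV hz]
      simp only [koszul, D.symm_γ _ (W _) (V _), D.symm_γ _ (ext z _) (V _),
        D.symm_γ _ (ext z _) (W _), D.U_symm x (W x) (V x), mlieBracket_swap_apply (V := W) (W := V),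
        mlieBracket_swap_apply (V := ext z) (W := W),
        mlieBracket_swap_apply (V := ext z) (W := V), map_neg, neg_apply]
      ring
    · rw [map_add, D.ell_nablaAux hV hW, D.ell_nablaAux hW hV]
      simp only [ellPart, D.U_symm x (W x) (V x), D.F_antisymm x (W x) (V x)]
      rw [D.F_apply hV hW]
      ring
  nabla_γ := by
    intro x u v w
    have hu := diffVF_ext u
    have hv := diffVF_ext v
    have hw := diffVF_ext w
    have h1 := D.γ_nablaAux hu hv hw
    have h2 := D.γ_nablaAux hu hw hv
    rw [← D.nabla_apply hu hv] at h1
    rw [← D.nabla_apply hu hw] at h2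
    simp only [ext_self] at h1 h2
    simp only [covTensor, γ₂]
    rw [h1, D.symm_γ x v, h2]
    simp only [koszul, D.symm_γ _ (ext w _) (ext v _), D.symm_γ _ (ext w _) (ext u _),
      D.symm_γ _ (ext v _) (ext u _), mlieBracket_swap_apply (V := ext w) (W := ext v),
      mlieBracket_swap_apply (V := ext w) (W := ext u),
      mlieBracket_swap_apply (V := ext v) (W := ext u), map_neg, neg_apply, ext_self]
    ring
  nabla_ell := by
    intro x u v
    have hu := diffVF_ext u
    have hv := diffVF_ext v
    have h1 := D.ell_nablaAux hu hv
    rw [← D.nabla_apply hu hv] at h1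
    simp only [ext_self] at h1
    simp only [covForm, ell₁]
    rw [h1]
    simp only [ellPart, ext_self]
    ring

end NullMetricData

namespace NullMetricData
variable {m : ℕ} {N : Type*} [TopologicalSpace N] [ChartedSpace (EuclideanSpace ℝ (Fin m)) N]
  [IsManifold (𝓡 m) ∞ N] (D : NullMetricData m N)
variable {D} in
/-- The conditions that characterize the metric hypersurface connection determine it (on
differentiable vector fields). -/
theorem IsMetricHypersurfaceConnection.unique {nab nab' : CovariantDerivative (𝓡 m)
    (EuclideanSpace ℝ (Fin m)) (TangentSpace (𝓡 m) : N → Type _)}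
    (h : D.IsMetricHypersurfaceConnection nab) (h' : D.IsMetricHypersurfaceConnection nab')
    {W : VField m N} {x : N} (hW : DiffVF W x) : nab W x = nab' W x := by
  have : IsManifold (𝓡 m) 1 N := IsManifold.of_le (n := ∞) (by simp)
  have hd : ∀ {V : VField m N}, DiffVF V x →
      nab.difference nab' x (V x) = nab V x - nab' V x := fun hV ↦
    IsCovariantDerivativeOn.difference_apply _ _ (Set.mem_univ x) hV
  set d := nab.difference nab' x
  have hde : ∀ u v, d v u = nab (ext v) x u - nab' (ext v) x u := fun u v ↦ by
    have := hd (diffVF_ext v)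
    rw [ext_self] at this
    rw [this, sub_apply]
  have hsymm : ∀ u v, d v u = d u v := by
    intro u v
    have h1 := (CovariantDerivative.torsion_eq_zero_iff nab).1 h.torsion_eq_zero
      (diffVF_ext u) (diffVF_ext v)
    have h2 := (CovariantDerivative.torsion_eq_zero_iff nab').1 h'.torsion_eq_zero
      (diffVF_ext u) (diffVF_ext v)
    simp only [ext_self] at h1 h2
    rw [hde, hde, sub_eq_sub_iff_sub_eq_sub, h1, h2]
  have hγ : ∀ u v w, D.γ x (d v u) w + D.γ x (d w u) v = 0 := by
    intro u v w
    have h1 := (h.nabla_γ x u v w).trans (h'.nabla_γ x u v w).symm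
    simp only [covTensor, γ₂, D.symm_γ x v] at h1
    simp only [hde, map_sub, sub_apply]
    linarith
  have hℓ : ∀ u v, D.ell x (d v u) = 0 := by
    intro u v
    have h1 := (h.nabla_ell x u v).trans (h'.nabla_ell x u v).symm
    simp only [covForm, ell₁] at h1
    simp only [hde, map_sub]
    linarith
  have h0 : ∀ u v, d v u = 0 := fun u v ↦ D.eq_of_γ_of_ell (fun w ↦ by
    have h1 := hγ u v w
    have h2 := hγ v w u
    have h3 := hγ w u v
    rw [hsymm u v] at h1 ⊢
    rw [hsymm v w] at h2
    rw [hsymm w u] at h3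
    rw [map_zero, zero_apply]
    linarith) (by rw [hℓ, map_zero])
  ext1 u
  have := congr_fun (congr_arg DFunLike.coe (hd hW)) u
  rw [h0, sub_apply] at this
  exact (sub_eq_zero.1 this.symm)
end NullMetricData

/-! ### `K`-tuples -/

/-- A `K`-tuple `{N, γ, ℓ, ℓ⁽²⁾, Y, α, p, q}`: null metric hypersurface data together with a smooth
symmetric `(0,2)`-tensor field `Y`, smooth functions `α`, `p` and a smooth covector field `q`. -/
structure KTuple (m : ℕ) (N : Type*) [TopologicalSpace N]
    [ChartedSpace (EuclideanSpace ℝ (Fin m)) N] [IsManifold (𝓡 m) ∞ N]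
    extends NullMetricData m N where
  Y : Π x : N, TangentSpace (𝓡 m) x →L[ℝ] TangentSpace (𝓡 m) x →L[ℝ] ℝ
  smooth_Y : SmoothTensor2 m N Y
  symm_Y : ∀ x v w, Y x v w = Y x w v
  α : N → ℝ
  smooth_α : ContMDiff (𝓡 m) 𝓘(ℝ, ℝ) ∞ α
  p : N → ℝ
  smooth_p : ContMDiff (𝓡 m) 𝓘(ℝ, ℝ) ∞ p
  q : Π x : N, TangentSpace (𝓡 m) x →L[ℝ] ℝ
  smooth_q : SmoothForm1 m N q

namespace KTuple

variable {m : ℕ} {N : Type*} [TopologicalSpace N] [ChartedSpace (EuclideanSpace ℝ (Fin m)) N]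
  [IsManifold (𝓡 m) ∞ N] (K : KTuple m N)

/-- `Y` as a field of functions of two tangent vectors. -/
def Y₂ : Tensor2 m N := fun x v w ↦ K.Y x v w

/-- `r = Y(n, ·)`. -/
def r : Form1 m N := fun x v ↦ K.Y x (K.n x) v

/-- `ω = s - r`. -/
def om : Form1 m N := fun x v ↦ K.s x v - K.r x v

/-- `κ_n = - Y(n, n)`. -/
def κn (x : N) : ℝ := - K.Y x (K.n x) (K.n x)

/-- The surface gravity `κ = n(α) + α κ_n`. -/
def κ (x : N) : ℝ := dir K.α x (K.n x) + K.α x * K.κn x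

/-- The vector field `η̄ = α n`. -/
def η : VField m N := fun x ↦ K.α x • K.n x

/-- The bilinear map `(W, X) ↦ Y(W, X) n = Y(X, W) n`. -/
def Yn (x : N) : TangentSpace (𝓡 m) x →L[ℝ] TangentSpace (𝓡 m) x →L[ℝ] TangentSpace (𝓡 m) x :=
  letI E := EuclideanSpace ℝ (Fin m)
  ((ContinuousLinearMap.smulRightL ℝ E E).flip (show E from K.n x)).comp
    (show E →L[ℝ] E →L[ℝ] ℝ from K.Y x)

/-- The hypersurface connection `∇̄_X W = ∇_X W - Y(X, W) n`. -/
def nablaBar : CovariantDerivative (𝓡 m) (EuclideanSpace ℝ (Fin m))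
    (TangentSpace (𝓡 m) : N → Type _) :=
  K.nabla.addOneForm fun x ↦ - K.Yn x

lemma nablaBar_apply (W : VField m N) (x : N) (v : TangentSpace (𝓡 m) x) :
    K.nablaBar W x v = K.nabla W x v - K.Y x v (W x) • K.n x := by
  rw [K.symm_Y, sub_eq_add_neg]
  rfl

/-- `P^{cd} S_{c(a} T_{b)d}`. -/
def contrP (S T : Tensor2 m N) : Tensor2 m N := symm fun x v w ↦
  ∑ c, ∑ d, K.P x c d * S x (e x c) v * T x w (e x d)

/-- The Ricci tensor of the metric hypersurface connection. -/
def Ric : Tensor2 m N := ricci K.nabla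

/-- The covector field `dα`. -/
def dα : Form1 m N := dir K.α

/-- The constraint tensor. -/
def constraint : Tensor2 m N := fun x v w ↦
  symm K.Ric x v w - 2 * lieDeriv K.n K.Y₂ x v w
    - (2 * K.om x (K.n x) + K.trP K.U x) * K.Y₂ x v w
    - 2 * symm (covForm K.nabla K.om) x v w - 2 * (K.om x v * K.om x w)
    + 3 * symm (covForm K.nabla K.s) x v w + K.s x v * K.s x w
    - K.trP K.Y₂ x * K.U x v w
    + 2 * (2 * K.contrP K.U K.Y₂ x v w + K.contrP K.U K.F x v w)

/-- The tensor `£_η̄ ∇̄`. -/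
def Sigma (x : N) (v w : TangentSpace (𝓡 m) x) : TangentSpace (𝓡 m) x :=
  lieConnection K.η K.nablaBar x v w

/-- The non-isolation tensor. -/
def Pi : Tensor2 m N := fun x v w ↦
  K.ell x (K.Sigma x v w)
    - (1 / 2) * (K.α x * dir K.ell2 x (K.n x) - K.p x) * K.U x v w
    - K.α x * K.ell2 x * lieDeriv K.n K.U x v w

/-- The tensor `α U`. -/
def αU : Tensor2 m N := fun x v w ↦ K.α x * K.U x v w

end KTuple

end
end NullHypersurface

/-!
Everything follows from two computations: a closed formula for the non-isolation tensor `Π` and a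
formula for the contraction of the Ricci tensor of the metric hypersurface connection `∇` with `n`.

**The non-isolation tensor** (`KTuple.Pi_eq`). Taking the Lie derivative of
`∇_a ℓ_b = F_ab - ℓ⁽²⁾ U_ab` along `n`, with `£_n ℓ = 2 s` and `£_n F = ds`, computes `ℓ(£_n ∇)`
(`ell_lieConnection_n`). Passing from `n` to `η̄ = α n` and from `∇` to `∇̄ = ∇ - Y ⊗ n` adds `∇∇α`,
products of `dα` with `ω` and the Lie derivative of `Y`; the result is
`Π_ab = ∇_a ∇_b α + 2 ω_(a ∇_b) α - α (£_n Y)_ab + n(α) Y_ab + 2 α ∇_(a s_b)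
  + ½ (α n(ℓ⁽²⁾) + p) U_ab`.
In the first identity the Ricci tensor drops out, so that this formula proves it by pure algebra.
Contracting it twice with `n` gives the third identity, since `∇_n n = 0`, `s(n) = 0` and
`ω(n) = κ_n`.

**The Ricci tensor** (`ricci_n`, `ricci_sub_ricci`). Since `∇_a n^b = s_a n^b + P^{bc} U_ac`, the
Ricci identity for `n`, traced with `δ^a_b = P^{ac} γ_cb + n^a ℓ_b`, gives
`Ric(n, ·)_a = P^{bc} ∇_b U_ac - ∇_a tr_P U` plus terms that contain `s`. The second identity involves
the symmetric part of `Ric` only. Its antisymmetric part is `½ ds`: by the first Bianchi identity it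
is given by the trace of the curvature endomorphism `R(u, v)`; in that trace `P^{ab}` meets only the
symmetric part of `γ(R(u, v) ·, ·)`, which the Ricci identity for `γ` computes. The second identity
is a linear combination of these formulas and of the one for `Π(·, n)`. The derivatives of `ω` along
`n` from `£_n Y` and `∇_(a ω_b)` cancel, and those of `ω(n) = κ_n` are the ones in `dκ`.

All tensorial quantities are handled by evaluating them on vector fields that are smooth near a
point. Smoothness of the fields and functions that arise is found by instance search, through the
classes `SmoothFieldAt`, `SmoothFunAt`, `IsSmoothForm` and `IsSmoothTensor`. That an operation
depends on the value of a vector field at the point only is shown by expansion in a local frame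
(`eq_of_tensorial`).
-/

namespace NullHypersurface

open Filter Topology

set_option linter.unusedSectionVars false

/-! ### Smooth vector fields and functions near a point -/

section SmoothGerms

variable {m : ℕ} {N : Type*} [TopologicalSpace N] [ChartedSpace (EuclideanSpace ℝ (Fin m)) N]

/-- A function is smooth near `x`. As a class, so that regularity side conditions are found by
instance search. -/
class SmoothFunAt (f : N → ℝ) (x : N) : Prop where
  eventually_contMDiffAt : ∀ᶠ y in 𝓝 x, ContMDiffAt (𝓡 m) 𝓘(ℝ, ℝ) ∞ f y

variable [IsManifold (𝓡 m) ∞ N]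

/-- A vector field is smooth near `x`. -/
class SmoothFieldAt (V : VField m N) (x : N) : Prop where
  eventually_contMDiffAt : ∀ᶠ y in 𝓝 x,
    ContMDiffAt (𝓡 m) ((𝓡 m).prod 𝓘(ℝ, EuclideanSpace ℝ (Fin m))) ∞
      (fun z ↦ TotalSpace.mk' (EuclideanSpace ℝ (Fin m)) z (V z)) y

/-- The function `V(f)`. -/
noncomputable def act (V : VField m N) (f : N → ℝ) : N → ℝ := fun y ↦ dir f y (V y)

/-- The function `θ(V)`. -/
def app₁ (θ : Form1 m N) (V : VField m N) : N → ℝ := fun y ↦ θ y (V y)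

/-- The function `T(V, W)`. -/
def app₂ (T : Tensor2 m N) (V W : VField m N) : N → ℝ := fun y ↦ T y (V y) (W y)

lemma SmoothFunAt.contMDiffAt (f : N → ℝ) (x : N) [h : SmoothFunAt (m := m) f x] :
    ContMDiffAt (𝓡 m) 𝓘(ℝ, ℝ) ∞ f x := h.1.self_of_nhds

lemma SmoothFunAt.mdiff (f : N → ℝ) (x : N) [SmoothFunAt (m := m) f x] :
    MDifferentiableAt (𝓡 m) 𝓘(ℝ, ℝ) f x :=
  (SmoothFunAt.contMDiffAt f x).mdifferentiableAt (by simp)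

lemma SmoothFunAt.eventually (f : N → ℝ) (x : N) [h : SmoothFunAt (m := m) f x] :
    ∀ᶠ y in 𝓝 x, SmoothFunAt (m := m) f y :=
  h.1.eventually_nhds.mono fun _ hy ↦ ⟨hy⟩

lemma SmoothFieldAt.contMDiffAt (V : VField m N) (x : N) [h : SmoothFieldAt V x] :
    ContMDiffAt (𝓡 m) ((𝓡 m).prod 𝓘(ℝ, EuclideanSpace ℝ (Fin m))) ∞
      (fun z ↦ TotalSpace.mk' (EuclideanSpace ℝ (Fin m)) z (V z)) x := h.1.self_of_nhds

lemma SmoothFieldAt.diffVF (V : VField m N) (x : N) [SmoothFieldAt V x] : DiffVF V x :=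
  (SmoothFieldAt.contMDiffAt V x).mdifferentiableAt (by simp)

lemma SmoothFieldAt.eventually (V : VField m N) (x : N) [h : SmoothFieldAt V x] :
    ∀ᶠ y in 𝓝 x, SmoothFieldAt V y :=
  h.1.eventually_nhds.mono fun _ hy ↦ ⟨hy⟩

lemma SmoothFunAt.congr {f g : N → ℝ} {x : N} (hf : SmoothFunAt (m := m) f x) (h : f =ᶠ[𝓝 x] g) :
    SmoothFunAt (m := m) g x where
  eventually_contMDiffAt := by
    filter_upwards [hf.1, h.eventuallyEq_nhds] with y hy hy'
    exact hy.congr_of_eventuallyEq hy'.symm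

lemma SmoothFieldAt.congr {V W : VField m N} {x : N} (hV : SmoothFieldAt V x)
    (h : ∀ᶠ y in 𝓝 x, V y = W y) : SmoothFieldAt W x where
  eventually_contMDiffAt := by
    filter_upwards [hV.1, h.eventually_nhds] with y hy hy'
    refine hy.congr_of_eventuallyEq ?_
    filter_upwards [hy'] with z hz
    rw [hz]

instance (c : ℝ) (x : N) : SmoothFunAt (m := m) (fun _ ↦ c) x :=
  ⟨.of_forall fun _ ↦ contMDiffAt_const⟩

instance (f g : N → ℝ) (x : N) [hf : SmoothFunAt (m := m) f x] [hg : SmoothFunAt (m := m) g x] :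
    SmoothFunAt (m := m) (f + g) x :=
  ⟨by filter_upwards [hf.1, hg.1] with y h h' using h.add h'⟩

instance (f g : N → ℝ) (x : N) [hf : SmoothFunAt (m := m) f x] [hg : SmoothFunAt (m := m) g x] :
    SmoothFunAt (m := m) (f - g) x :=
  ⟨by filter_upwards [hf.1, hg.1] with y h h' using h.sub h'⟩

instance (f g : N → ℝ) (x : N) [hf : SmoothFunAt (m := m) f x] [hg : SmoothFunAt (m := m) g x] :
    SmoothFunAt (m := m) (f * g) x :=
  ⟨by filter_upwards [hf.1, hg.1] with y h h' using h.mul h'⟩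

instance (c : ℝ) (f : N → ℝ) (x : N) [hf : SmoothFunAt (m := m) f x] :
    SmoothFunAt (m := m) (c • f) x :=
  ⟨by filter_upwards [hf.1] with y h using contMDiffAt_const.mul h⟩

instance (V W : VField m N) (x : N) [hV : SmoothFieldAt V x] [hW : SmoothFieldAt W x] :
    SmoothFieldAt (V + W) x :=
  ⟨by filter_upwards [hV.1, hW.1] with y h h' using h.add_section h'⟩

instance (V W : VField m N) (x : N) [hV : SmoothFieldAt V x] [hW : SmoothFieldAt W x] :
    SmoothFieldAt (V - W) x :=
  ⟨by filter_upwards [hV.1, hW.1] with y h h' using h.sub_section h'⟩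

instance (f : N → ℝ) (V : VField m N) (x : N) [hf : SmoothFunAt (m := m) f x]
    [hV : SmoothFieldAt V x] : SmoothFieldAt (f • V) x :=
  ⟨by filter_upwards [hf.1, hV.1] with y h h' using h.smul_section h'⟩

instance (V W : VField m N) (x : N) [hV : SmoothFieldAt V x] [hW : SmoothFieldAt W x] :
    SmoothFieldAt (mlieBracket (𝓡 m) V W) x :=
  ⟨by
    have : IsManifold (𝓡 m) (minSmoothness ℝ 2) N := by
      rw [minSmoothness_of_isRCLikeNormedField]
      exact IsManifold.of_le (n := ∞) (by exact WithTop.coe_le_coe.2 le_top)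
    have : IsManifold (𝓡 m) ((⊤ : ℕ∞) + 1) N := ‹IsManifold (𝓡 m) ∞ N›
    filter_upwards [hV.1, hW.1] with y h h'
    exact ContMDiffAt.mlieBracket_vectorField (m := ⊤) (n := ⊤) h h' (by simp)⟩

instance {x : N} (v : TangentSpace (𝓡 m) x) : SmoothFieldAt (ext v) x := by
  obtain ⟨s, hs, h⟩ := exists_contMDiffOn_extend (k := ∞) (𝓡 m) (EuclideanSpace ℝ (Fin m)) v
  refine ⟨?_⟩
  filter_upwards [eventually_mem_nhds_iff.2 hs] with y hy
  exact h.contMDiffAt hy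

instance (D : NullMetricData m N) (x : N) : SmoothFieldAt D.n x :=
  ⟨.of_forall D.contMDiffAt_n⟩

instance (D : NullMetricData m N) (x : N) : SmoothFunAt (m := m) D.ell2 x :=
  ⟨.of_forall D.smooth_ell2⟩

end SmoothGerms

section Derivatives

variable {m : ℕ} {N : Type*} [TopologicalSpace N] [ChartedSpace (EuclideanSpace ℝ (Fin m)) N]

lemma dir_congr {f g : N → ℝ} {x : N} (h : f =ᶠ[𝓝 x] g) (v : TangentSpace (𝓡 m) x) :
    dir f x v = dir g x v := by
  simp only [dir, mvfderiv, h.mfderiv_eq]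
  rfl

lemma dir_zero (f : N → ℝ) (x : N) : dir f x (0 : TangentSpace (𝓡 m) x) = 0 := by simp [dir]

lemma dir_vsub (f : N → ℝ) (x : N) (v w : TangentSpace (𝓡 m) x) :
    dir f x (v - w) = dir f x v - dir f x w := by simp [dir]

variable [IsManifold (𝓡 m) ∞ N]

lemma dir_fun_add (f g : N → ℝ) (x : N) [SmoothFunAt (m := m) f x] [SmoothFunAt (m := m) g x]
    (v : TangentSpace (𝓡 m) x) : dir (f + g) x v = dir f x v + dir g x v :=
  dir_add (SmoothFunAt.mdiff f x) (SmoothFunAt.mdiff g x) v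

lemma dir_fun_mul (f g : N → ℝ) (x : N) [SmoothFunAt (m := m) f x] [SmoothFunAt (m := m) g x]
    (v : TangentSpace (𝓡 m) x) : dir (f * g) x v = f x * dir g x v + g x * dir f x v :=
  dir_mul (SmoothFunAt.mdiff f x) (SmoothFunAt.mdiff g x) v

lemma dir_fun_sub (f g : N → ℝ) (x : N) [SmoothFunAt (m := m) f x] [SmoothFunAt (m := m) g x]
    (v : TangentSpace (𝓡 m) x) : dir (f - g) x v = dir f x v - dir g x v := by
  simp [dir, mvfderiv_sub (SmoothFunAt.mdiff (m := m) f x) (SmoothFunAt.mdiff (m := m) g x)]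

lemma dir_fun_smul (c : ℝ) (f : N → ℝ) (x : N) [SmoothFunAt (m := m) f x]
    (v : TangentSpace (𝓡 m) x) : dir (c • f) x v = c * dir f x v := by
  have := dir_mul (f := fun _ ↦ c) mdifferentiableAt_const (SmoothFunAt.mdiff (m := m) f x) v
  rw [dir_const, mul_zero, add_zero] at this
  exact this

lemma bracket_congr {V V' W W' : VField m N} {x : N} (h : ∀ᶠ y in 𝓝 x, V y = V' y)
    (h' : ∀ᶠ y in 𝓝 x, W y = W' y) :
    mlieBracket (𝓡 m) V W x = mlieBracket (𝓡 m) V' W' x :=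
  EventuallyEq.mlieBracket_vectorField_eq h h'

lemma bracket_smul_right (f : N → ℝ) (V W : VField m N) (x : N) [SmoothFunAt (m := m) f x]
    [SmoothFieldAt W x] : mlieBracket (𝓡 m) V (f • W) x =
      act V f x • W x + f x • mlieBracket (𝓡 m) V W x :=
  br_smul_right V (SmoothFunAt.mdiff f x) (SmoothFieldAt.diffVF W x)

lemma bracket_smul_left (f : N → ℝ) (V W : VField m N) (x : N) [SmoothFunAt (m := m) f x]
    [SmoothFieldAt V x] : mlieBracket (𝓡 m) (f • V) W x =
      -act W f x • V x + f x • mlieBracket (𝓡 m) V W x :=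
  br_smul_left W (SmoothFunAt.mdiff f x) (SmoothFieldAt.diffVF V x)

lemma bracket_add_right (V W W' : VField m N) (x : N) [SmoothFieldAt W x] [SmoothFieldAt W' x] :
    mlieBracket (𝓡 m) V (W + W') x = mlieBracket (𝓡 m) V W x + mlieBracket (𝓡 m) V W' x :=
  br_add_right V (SmoothFieldAt.diffVF W x) (SmoothFieldAt.diffVF W' x)

lemma bracket_sub_right (V W W' : VField m N) (x : N) [SmoothFieldAt W x] [SmoothFieldAt W' x] :
    mlieBracket (𝓡 m) V (W - W') x = mlieBracket (𝓡 m) V W x - mlieBracket (𝓡 m) V W' x := by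
  have := bracket_add_right V (W - W') W' x
  rw [sub_add_cancel] at this
  rw [this, add_sub_cancel_right]

lemma jacobi (U V W : VField m N) (x : N) [SmoothFieldAt U x] [SmoothFieldAt V x]
    [SmoothFieldAt W x] : mlieBracket (𝓡 m) U (mlieBracket (𝓡 m) V W) x =
      mlieBracket (𝓡 m) (mlieBracket (𝓡 m) U V) W x +
        mlieBracket (𝓡 m) V (mlieBracket (𝓡 m) U W) x := by
  have : IsManifold (𝓡 m) (minSmoothness ℝ 3) N := by
    rw [minSmoothness_of_isRCLikeNormedField]
    exact IsManifold.of_le (n := ∞) (by exact WithTop.coe_le_coe.2 le_top)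
  refine leibniz_identity_mlieBracket_apply ?_ ?_ ?_ <;>
  · rw [minSmoothness_of_isRCLikeNormedField]
    exact (SmoothFieldAt.contMDiffAt _ x).of_le (by exact WithTop.coe_le_coe.2 le_top)

end Derivatives

/-! ### Local frames -/

section Frame

variable {m : ℕ} {N : Type*} [TopologicalSpace N] [ChartedSpace (EuclideanSpace ℝ (Fin m)) N]
  [IsManifold (𝓡 m) ∞ N]

/-- The trivialization of the tangent bundle in the preferred chart at `x`. -/
noncomputable abbrev triv (x : N) :=
  trivializationAt (EuclideanSpace ℝ (Fin m)) (TangentSpace (𝓡 m) : N → Type _) x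

/-- The components of a vector field in the frame `ext (e x a)` near `x`. -/
noncomputable def frameCo (x : N) (V : VField m N) (a : Fin m) : N → ℝ := fun y ↦
  (triv (m := m) x).localFrameCoeff (𝓡 m) (EuclideanSpace.basisFun (Fin m) ℝ).toBasis a y (V y)

lemma mem_baseSet (x : N) : ∀ᶠ y in 𝓝 x, y ∈ (triv (m := m) x).baseSet :=
  (triv (m := m) x).open_baseSet.mem_nhds (FiberBundle.mem_baseSet_trivializationAt' x)

lemma triv_self {x : N} (v : TangentSpace (𝓡 m) x) :
    ((triv (m := m) x) ⟨x, v⟩).2 = v := by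
  rw [TangentBundle.trivializationAt_apply]
  exact (tangentBundleCore (𝓡 m) N).coordChange_self (achart _ x) x
    (mem_chart_source (EuclideanSpace ℝ (Fin m)) x) v

lemma ext_e_apply {x y : N} (hy : y ∈ (triv (m := m) x).baseSet) (a : Fin m) :
    ext (e x a) y =
      (triv (m := m) x).basisAt (EuclideanSpace.basisFun (Fin m) ℝ).toBasis hy a := by
  have h : ext (e x a) y = (triv (m := m) x).symm y ((triv (m := m) x) ⟨x, e x a⟩).2 := rfl
  rw [h, triv_self]
  simp [Trivialization.basisAt, e]

lemma frame_expansion (x : N) (V : VField m N) :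
    ∀ᶠ y in 𝓝 x, V y = (∑ a, frameCo x V a • ext (e x a)) y := by
  filter_upwards [mem_baseSet (m := m) x] with y hy
  rw [(triv (m := m) x).eq_sum_localFrameCoeff_smul (I := 𝓡 m)
    (b := (EuclideanSpace.basisFun (Fin m) ℝ).toBasis) (s := V) hy]
  simp only [Finset.sum_apply, frameCo, ext_e_apply hy, Pi.smul_apply']
  refine Finset.sum_congr rfl fun a _ ↦ ?_
  rw [(triv (m := m) x).localFrame_apply_of_mem_baseSet _ hy]

lemma contMDiffAt_frameCo {x y : N} (hy : y ∈ (triv (m := m) x).baseSet) {V : VField m N}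
    (hV : ContMDiffAt (𝓡 m) ((𝓡 m).prod 𝓘(ℝ, EuclideanSpace ℝ (Fin m))) ∞
      (fun z ↦ TotalSpace.mk' (EuclideanSpace ℝ (Fin m)) z (V z)) y) (a : Fin m) :
    ContMDiffAt (𝓡 m) 𝓘(ℝ, ℝ) ∞ (frameCo x V a) y :=
  contMDiffAt_localFrameCoeff (I := 𝓡 m) (k := ∞) (e := triv (m := m) x)
    (EuclideanSpace.basisFun (Fin m) ℝ).toBasis hy hV a

instance (x : N) (V : VField m N) (a : Fin m) [h : SmoothFieldAt V x] :
    SmoothFunAt (m := m) (frameCo x V a) x :=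
  ⟨by filter_upwards [h.1, mem_baseSet (m := m) x] with y h hy using contMDiffAt_frameCo hy h a⟩

lemma frameCo_self (x : N) (V : VField m N) (a : Fin m) : frameCo x V a x = co (V x) a := by
  conv_rhs => rw [(frame_expansion x V).self_of_nhds]
  simp [Finset.sum_apply, ext_self, co_sum_smul_e]

lemma frameCo_ext (x : N) (a b : Fin m) :
    ∀ᶠ y in 𝓝 x, frameCo x (ext (e x a)) b y = if a = b then 1 else 0 := by
  filter_upwards [mem_baseSet (m := m) x] with y hy
  rw [frameCo, (triv (m := m) x).localFrameCoeff_apply_of_mem_baseSet _ hy, ext_e_apply hy]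
  simp [Finsupp.single_apply]

/-! ### Derivatives along vector fields -/

instance (V : VField m N) (f : N → ℝ) (x : N) [SmoothFieldAt V x]
    [SmoothFunAt (m := m) f x] : SmoothFunAt (m := m) (act V f) x := by
  -- `V(f) W = [V, f W] - f [V, W]`, and brackets of smooth fields are smooth.
  rcases m with _ | m
  · have h : SmoothFunAt (m := 0) (fun _ : N ↦ (0 : ℝ)) x := inferInstance
    refine h.congr (.of_forall fun y ↦ ?_)
    have h0 : V y = 0 := ext_of_co (by simp)
    rw [act, h0, dir_zero]
  · set W : VField (m + 1) N := ext (e x 0)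
    have h : SmoothFunAt (m := m + 1)
      (frameCo x (mlieBracket (𝓡 (m + 1)) V (f • W) - f • mlieBracket (𝓡 (m + 1)) V W) 0) x :=
      inferInstance
    refine h.congr ?_
    filter_upwards [SmoothFunAt.eventually (m := m + 1) f x, SmoothFieldAt.eventually W x,
      frameCo_ext (m := m + 1) x 0 0] with y hf hy h1
    have h2 : (mlieBracket (𝓡 (m + 1)) V (f • W) - f • mlieBracket (𝓡 (m + 1)) V W) y =
        act V f y • W y := by
      rw [Pi.sub_apply, bracket_smul_right, Pi.smul_apply', add_sub_cancel_right]
    rw [frameCo, h2, map_smul]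
    change act V f y * frameCo x W 0 y = _
    rw [h1, if_pos rfl, mul_one]

/-- The bracket of vector fields is the commutator of derivations. -/
lemma dir_bracket (U V : VField m N) (f : N → ℝ) (x : N)
    [SmoothFieldAt U x] [SmoothFieldAt V x] [SmoothFunAt (m := m) f x] :
    dir f x (mlieBracket (𝓡 m) U V x) = act U (act V f) x - act V (act U f) x := by
  -- This is the `W`-component of the Jacobi identity for `U`, `V` and `f W`.
  have key : ∀ A B W : VField m N, [SmoothFieldAt A x] → [SmoothFieldAt B x] →
      [SmoothFieldAt W x] → mlieBracket (𝓡 m) A (mlieBracket (𝓡 m) B (f • W)) x =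
        act A (act B f) x • W x + act B f x • mlieBracket (𝓡 m) A W x
        + (act A f x • mlieBracket (𝓡 m) B W x
          + f x • mlieBracket (𝓡 m) A (mlieBracket (𝓡 m) B W) x) := by
    intro A B W _ _ _
    have h : ∀ᶠ y in 𝓝 x, mlieBracket (𝓡 m) B (f • W) y =
        (act B f • W + f • mlieBracket (𝓡 m) B W) y := by
      filter_upwards [SmoothFunAt.eventually (m := m) f x, SmoothFieldAt.eventually W x] with y _ _
      exact bracket_smul_right f B W y
    rw [bracket_congr (.of_forall fun _ ↦ rfl) h, bracket_add_right, bracket_smul_right,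
      bracket_smul_right]
  rcases m with _ | m
  · have h : ∀ v : TangentSpace (𝓡 0) x, v = 0 := fun v ↦ ext_of_co (by simp)
    simp only [act, h, dir_zero, sub_zero]
  · set W : VField (m + 1) N := ext (e x 0) with hW
    have h := jacobi U V (f • W) x
    rw [key U V W, key V U W, bracket_smul_right, jacobi U V W x] at h
    have hW1 : co (W x) 0 = 1 := by rw [hW, ext_self]; simp [co, e]
    have h' := congr_arg (fun v ↦ co v 0) h
    simp only [co_add, co_smul, hW1] at h'
    change act (mlieBracket (𝓡 (m + 1)) U V) f x = _
    linarith

/-- The components of an operation on vector fields that is local, additive and linear over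
functions at `x`. -/
lemma tensorial_expansion {x : N} {Φ : VField m N → ℝ}
    (hcongr : ∀ V W, [SmoothFieldAt V x] → [SmoothFieldAt W x] → (∀ᶠ y in 𝓝 x, V y = W y) →
      Φ V = Φ W)
    (hadd : ∀ V W, [SmoothFieldAt V x] → [SmoothFieldAt W x] → Φ (V + W) = Φ V + Φ W)
    (hsmul : ∀ (f : N → ℝ) V, [SmoothFunAt (m := m) f x] → [SmoothFieldAt V x] →
      Φ (f • V) = f x * Φ V)
    (V : VField m N) [SmoothFieldAt V x] : Φ V = ∑ a, co (V x) a * Φ (ext (e x a)) := by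
  have hs : ∀ t : Finset (Fin m), SmoothFieldAt (∑ a ∈ t, frameCo x V a • ext (e x a)) x ∧
      Φ (∑ a ∈ t, frameCo x V a • ext (e x a)) = ∑ a ∈ t, co (V x) a * Φ (ext (e x a)) := by
    intro t
    classical
    induction t using Finset.induction_on with
    | empty =>
      have h0 : (0 : VField m N) = (fun _ : N ↦ (0 : ℝ)) • V := by ext1 y; simp
      have h1 : SmoothFieldAt ((fun _ : N ↦ (0 : ℝ)) • V) x := inferInstance
      rw [Finset.sum_empty, Finset.sum_empty, h0, hsmul, zero_mul]
      exact ⟨h1, rfl⟩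
    | insert a t ha ih =>
      obtain ⟨_, ih⟩ := ih
      rw [Finset.sum_insert ha, Finset.sum_insert ha, hadd, hsmul, ih, frameCo_self]
      exact ⟨inferInstance, rfl⟩
  obtain ⟨_, h2⟩ := hs Finset.univ
  rw [hcongr V _ (frame_expansion x V), h2]

/-- An operation on vector fields that is local, additive and linear over functions at `x` depends
on the value at `x` only. -/
lemma eq_of_tensorial {x : N} {Φ : VField m N → ℝ}
    (hcongr : ∀ V W, [SmoothFieldAt V x] → [SmoothFieldAt W x] → (∀ᶠ y in 𝓝 x, V y = W y) →
      Φ V = Φ W)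
    (hadd : ∀ V W, [SmoothFieldAt V x] → [SmoothFieldAt W x] → Φ (V + W) = Φ V + Φ W)
    (hsmul : ∀ (f : N → ℝ) V, [SmoothFunAt (m := m) f x] → [SmoothFieldAt V x] →
      Φ (f • V) = f x * Φ V)
    {V W : VField m N} [SmoothFieldAt V x] [SmoothFieldAt W x] (h : V x = W x) : Φ V = Φ W := by
  rw [tensorial_expansion hcongr hadd hsmul V, tensorial_expansion hcongr hadd hsmul W, h]

end Frame

/-! ### Tensor fields as operations on smooth vector fields -/

section Tensors

variable {m : ℕ} {N : Type*} [TopologicalSpace N] [ChartedSpace (EuclideanSpace ℝ (Fin m)) N]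
  [IsManifold (𝓡 m) ∞ N]

/-- A field of functions of one tangent vector is a smooth covector field: it is linear on each
tangent space and takes smooth vector fields to smooth functions. -/
class IsSmoothForm (θ : Form1 m N) : Prop where
  add : ∀ x v w, θ x (v + w) = θ x v + θ x w
  smul : ∀ x (c : ℝ) v, θ x (c • v) = c * θ x v
  smooth : ∀ V x [SmoothFieldAt V x], SmoothFunAt (m := m) (app₁ θ V) x

/-- A field of functions of two tangent vectors is a smooth `(0,2)`-tensor field. -/
class IsSmoothTensor (T : Tensor2 m N) : Prop where
  add_left : ∀ x v v' w, T x (v + v') w = T x v w + T x v' w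
  smul_left : ∀ x (c : ℝ) v w, T x (c • v) w = c * T x v w
  add_right : ∀ x v w w', T x v (w + w') = T x v w + T x v w'
  smul_right : ∀ x (c : ℝ) v w, T x v (c • w) = c * T x v w
  smooth : ∀ V W x [SmoothFieldAt V x] [SmoothFieldAt W x], SmoothFunAt (m := m) (app₂ T V W) x

attribute [instance] IsSmoothForm.smooth IsSmoothTensor.smooth

namespace IsSmoothForm

variable (θ : Form1 m N) [IsSmoothForm θ] (x : N)

lemma zero : θ x 0 = 0 := by simpa using smul (θ := θ) x 0 0

lemma neg (v) : θ x (-v) = -θ x v := by simpa using smul (θ := θ) x (-1) v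

lemma sub (v w) : θ x (v - w) = θ x v - θ x w := by rw [sub_eq_add_neg, add (θ := θ), neg θ]; ring

end IsSmoothForm

lemma isSmoothForm_of_smoothForm1 {θ : Π x : N, TangentSpace (𝓡 m) x →L[ℝ] ℝ}
    (hθ : SmoothForm1 m N θ) : IsSmoothForm (fun x v ↦ θ x v : Form1 m N) where
  add _ _ _ := map_add _ _ _
  smul _ _ _ := map_smul _ _ _
  smooth _ _ hV := ⟨hV.1.mono fun _ h ↦ hθ.contMDiffAt h⟩

lemma isSmoothTensor_of_smoothTensor2
    {T : Π x : N, TangentSpace (𝓡 m) x →L[ℝ] TangentSpace (𝓡 m) x →L[ℝ] ℝ}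
    (hT : SmoothTensor2 m N T) : IsSmoothTensor (fun x v w ↦ T x v w : Tensor2 m N) where
  add_left _ _ _ _ := by rw [map_add]; rfl
  smul_left _ _ _ _ := by rw [map_smul]; rfl
  add_right _ _ _ _ := map_add _ _ _
  smul_right _ _ _ _ := map_smul _ _ _
  smooth _ _ _ hV hW := ⟨by filter_upwards [hV.1, hW.1] with y h h' using hT.contMDiffAt h h'⟩

instance (D : NullMetricData m N) : IsSmoothForm D.ell₁ := isSmoothForm_of_smoothForm1 D.smooth_ell

instance (D : NullMetricData m N) : IsSmoothTensor D.γ₂ :=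
  isSmoothTensor_of_smoothTensor2 D.smooth_γ

instance (K : KTuple m N) : IsSmoothTensor K.Y₂ := isSmoothTensor_of_smoothTensor2 K.smooth_Y

instance (T : Tensor2 m N) [IsSmoothTensor T] (D : NullMetricData m N) :
    IsSmoothForm (fun x v ↦ T x (D.n x) v) where
  add _ _ _ := IsSmoothTensor.add_right ..
  smul _ _ _ := IsSmoothTensor.smul_right ..
  smooth V x _ := IsSmoothTensor.smooth (T := T) D.n V x

end Tensors

/-! ### The metric hypersurface connection on smooth vector fields -/

namespace NullMetricData

variable {m : ℕ} {N : Type*} [TopologicalSpace N] [ChartedSpace (EuclideanSpace ℝ (Fin m)) N]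
  [IsManifold (𝓡 m) ∞ N] (D : NullMetricData m N)

instance : IsSmoothTensor D.U where
  add_left := D.U_add_left
  smul_left := D.U_smul_left
  add_right := D.U_add_right
  smul_right := D.U_smul_right
  smooth V W x _ _ := by
    have h : SmoothFunAt (m := m) ((1 / 2 : ℝ) • (act D.n (app₂ D.γ₂ V W)
      - app₂ D.γ₂ (mlieBracket (𝓡 m) D.n V) W - app₂ D.γ₂ V (mlieBracket (𝓡 m) D.n W))) x :=
      inferInstance
    refine h.congr ?_
    filter_upwards [SmoothFieldAt.eventually V x, SmoothFieldAt.eventually W x] with y _ _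
    exact (D.U_apply (SmoothFieldAt.diffVF V y) (SmoothFieldAt.diffVF W y)).symm

instance : IsSmoothTensor D.F where
  add_left := D.F_add_left
  smul_left := D.F_smul_left
  add_right := D.F_add_right
  smul_right := D.F_smul_right
  smooth V W x _ _ := by
    have h : SmoothFunAt (m := m) ((1 / 2 : ℝ) • (act V (app₁ D.ell₁ W) - act W (app₁ D.ell₁ V)
      - app₁ D.ell₁ (mlieBracket (𝓡 m) V W))) x := inferInstance
    refine h.congr ?_
    filter_upwards [SmoothFieldAt.eventually V x, SmoothFieldAt.eventually W x] with y _ _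
    exact (D.F_apply (SmoothFieldAt.diffVF V y) (SmoothFieldAt.diffVF W y)).symm

instance : IsSmoothForm D.s := inferInstanceAs (IsSmoothForm fun x v ↦ D.F x (D.n x) v)

/-- The vector field `∇_V W`. -/
noncomputable def cov (V W : VField m N) : VField m N := fun x ↦ D.nabla W x (V x)

lemma app₂_γ_cov (V W Z : VField m N) (x : N) [SmoothFieldAt V x] [SmoothFieldAt W x]
    [SmoothFieldAt Z x] : D.γ x (D.cov V W x) (Z x) = D.koszul x V W Z := by
  rw [cov, D.nabla_apply (SmoothFieldAt.diffVF V x) (SmoothFieldAt.diffVF W x),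
    D.γ_nablaAux (SmoothFieldAt.diffVF V x) (SmoothFieldAt.diffVF W x) (SmoothFieldAt.diffVF Z x)]

lemma app₁_ell_cov (V W : VField m N) (x : N) [SmoothFieldAt V x] [SmoothFieldAt W x] :
    D.ell x (D.cov V W x) = D.ellPart x V W := by
  rw [cov, D.nabla_apply (SmoothFieldAt.diffVF V x) (SmoothFieldAt.diffVF W x),
    D.ell_nablaAux (SmoothFieldAt.diffVF V x) (SmoothFieldAt.diffVF W x)]

instance (V W : VField m N) (x : N) [SmoothFieldAt V x] [SmoothFieldAt W x] :
    SmoothFieldAt (D.cov V W) x := by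
  refine ⟨?_⟩
  filter_upwards [SmoothFieldAt.eventually V x, SmoothFieldAt.eventually W x] with y hV hW
  refine D.contMDiffAt_of_lower (fun Z hZ ↦ ?_) ?_
  · have h1 : ∀ a, SmoothFunAt (m := m) (app₂ D.γ₂ (D.cov V W) (ext (e y a))) y := fun a ↦ by
      set Z : VField m N := ext (e y a)
      have h : SmoothFunAt (m := m) ((1 / 2 : ℝ) • (act V (app₂ D.γ₂ W Z) + act W (app₂ D.γ₂ Z V)
          - act Z (app₂ D.γ₂ V W) + app₂ D.γ₂ (mlieBracket (𝓡 m) V W) Z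
          - app₂ D.γ₂ (mlieBracket (𝓡 m) W Z) V + app₂ D.γ₂ (mlieBracket (𝓡 m) Z V) W)
          + app₁ D.ell₁ Z * app₂ D.U V W) y := inferInstance
      refine h.congr ?_
      filter_upwards [SmoothFieldAt.eventually V y, SmoothFieldAt.eventually W y,
        SmoothFieldAt.eventually Z y] with z _ _ _
      exact (D.app₂_γ_cov V W Z z).symm
    have h2 : ContMDiffAt (𝓡 m) 𝓘(ℝ, ℝ) ∞ (fun z ↦ ∑ a, frameCo y Z a z *
        app₂ D.γ₂ (D.cov V W) (ext (e y a)) z) y :=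
      ContMDiffAt.sum fun a _ ↦ (contMDiffAt_frameCo (mem_baseSet (m := m) y).self_of_nhds hZ a).mul
        (h1 a).contMDiffAt
    refine h2.congr_of_eventuallyEq ?_
    filter_upwards [frame_expansion y Z] with z hz
    conv_lhs => rw [hz]
    simp [Finset.sum_apply, app₂, γ₂]
  · have h : SmoothFunAt (m := m) (act V (app₁ D.ell₁ W) - app₂ D.F V W
        + D.ell2 * app₂ D.U V W) y := inferInstance
    refine (h.congr ?_).contMDiffAt
    filter_upwards [SmoothFieldAt.eventually V y, SmoothFieldAt.eventually W y] with z _ _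
    exact (D.app₁_ell_cov V W z).symm

lemma nabla_add (V W : VField m N) (x : N) [SmoothFieldAt V x] [SmoothFieldAt W x]
    (u : TangentSpace (𝓡 m) x) : D.nabla (V + W) x u = D.nabla V x u + D.nabla W x u := by
  rw [D.nabla.isCovariantDerivativeOnUniv.add (SmoothFieldAt.diffVF V x) (SmoothFieldAt.diffVF W x)]
  rfl

lemma nabla_sub (V W : VField m N) (x : N) [SmoothFieldAt V x] [SmoothFieldAt W x]
    (u : TangentSpace (𝓡 m) x) : D.nabla (V - W) x u = D.nabla V x u - D.nabla W x u := by
  have := D.nabla_add (V - W) W x u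
  rw [sub_add_cancel] at this
  rw [this, add_sub_cancel_right]

lemma nabla_smul (f : N → ℝ) (V : VField m N) (x : N) [SmoothFunAt (m := m) f x]
    [SmoothFieldAt V x] (u : TangentSpace (𝓡 m) x) :
    D.nabla (f • V) x u = f x • D.nabla V x u + dir f x u • V x := by
  rw [D.nabla.isCovariantDerivativeOnUniv.leibniz (SmoothFieldAt.diffVF V x)
    (SmoothFunAt.mdiff f x)]
  rfl

lemma nabla_congr {V W : VField m N} {x : N} [hV : SmoothFieldAt V x]
    (h : ∀ᶠ y in 𝓝 x, V y = W y) : D.nabla V x = D.nabla W x := by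
  have hW : SmoothFieldAt W x := hV.congr h
  have : IsManifold (𝓡 m) 1 N := IsManifold.of_le (n := ∞) (by simp)
  exact D.nabla.isCovariantDerivativeOnUniv.congr_of_eventuallyEq (SmoothFieldAt.diffVF V x)
    (SmoothFieldAt.diffVF W x) univ_mem h

lemma bracket_eq (V W : VField m N) (x : N) [SmoothFieldAt V x] [SmoothFieldAt W x] :
    mlieBracket (𝓡 m) V W x = D.cov V W x - D.cov W V x :=
  ((CovariantDerivative.torsion_eq_zero_iff D.nabla).1 D.nabla_spec.torsion_eq_zero
    (SmoothFieldAt.diffVF V x) (SmoothFieldAt.diffVF W x)).symm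

/-- `∇_a γ_{bc} = - ℓ_b U_{ac} - ℓ_c U_{ab}`, on vector fields. -/
lemma dir_γ (V W : VField m N) (x : N) [SmoothFieldAt V x] [SmoothFieldAt W x]
    (u : TangentSpace (𝓡 m) x) : dir (app₂ D.γ₂ V W) x u =
      D.γ x (D.nabla V x u) (W x) + D.γ x (V x) (D.nabla W x u)
        - D.ell x (V x) * D.U x u (W x) - D.ell x (W x) * D.U x u (V x) := by
  have h1 := D.app₂_γ_cov (ext u) V W x
  have h2 := D.app₂_γ_cov (ext u) W V x
  simp only [cov, ext_self] at h1 h2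
  rw [h1, D.symm_γ x (V x), h2]
  simp only [koszul, D.symm_γ _ (W _) (V _), D.symm_γ _ (W _) (ext u _),
    D.symm_γ _ (V _) (ext u _), mlieBracket_swap_apply (V := W) (W := V),
    mlieBracket_swap_apply (V := W) (W := ext u),
    mlieBracket_swap_apply (V := V) (W := ext u), map_neg, neg_apply, ext_self]
  change dir (fun y ↦ D.γ y (V y) (W y)) x u = _
  ring

/-- `∇_a ℓ_b = F_{ab} - ℓ⁽²⁾ U_{ab}`, on vector fields. -/
lemma dir_ell (V : VField m N) (x : N) [SmoothFieldAt V x] (u : TangentSpace (𝓡 m) x) :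
    dir (app₁ D.ell₁ V) x u =
      D.ell x (D.nabla V x u) + D.F x u (V x) - D.ell2 x * D.U x u (V x) := by
  have h1 := D.app₁_ell_cov (ext u) V x
  simp only [cov, ext_self] at h1
  rw [h1, ellPart, ext_self]
  change dir (fun y ↦ D.ell y (V y)) x u = _
  ring

lemma U_n_right (x : N) (v) : D.U x v (D.n x) = 0 := by
  have h := D.U_apply (diffVF_ext v) (D.diffVF_n x)
  have h1 : (fun y ↦ D.γ y (ext v y) (D.n y)) = fun _ ↦ 0 := by
    ext y; rw [D.symm_γ, D.γ_n]
  rw [ext_self, h1, dir_const, mlieBracket_self, D.symm_γ x _ (D.n x), D.γ_n] at h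
  simpa using h

lemma U_n_left (x : N) (v) : D.U x (D.n x) v = 0 := by rw [D.U_symm, U_n_right]

lemma F_n_right (x : N) (v) : D.F x v (D.n x) = -D.s x v := D.F_antisymm x _ _

lemma s_n (x : N) : D.s x (D.n x) = 0 := by
  have : D.F x (D.n x) (D.n x) = -D.F x (D.n x) (D.n x) := D.F_antisymm x _ _
  change D.F x (D.n x) (D.n x) = 0
  linarith

/-- `∇_a n^c γ_{cb} = U_{ab}`. -/
lemma γ_nabla_n (x : N) (u w : TangentSpace (𝓡 m) x) :
    D.γ x (D.nabla D.n x u) w = D.U x u w := by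
  have h := D.dir_γ D.n (ext w) x u
  have h1 : app₂ D.γ₂ D.n (ext w) = fun _ ↦ 0 := by
    ext y; simp [app₂, γ₂, D.γ_n]
  rw [h1, dir_const, D.γ_n, U_n_right, D.ell_n, ext_self] at h
  linarith

/-- `∇_a n^c ℓ_c = s_a`. -/
lemma ell_nabla_n (x : N) (u : TangentSpace (𝓡 m) x) : D.ell x (D.nabla D.n x u) = D.s x u := by
  have h := D.dir_ell D.n x u
  have h1 : app₁ D.ell₁ D.n = fun _ ↦ 1 := by
    ext y; simp [app₁, ell₁, D.ell_n]
  rw [h1, dir_const, U_n_right, F_n_right] at h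
  linarith

lemma nabla_n_n (x : N) : D.nabla D.n x (D.n x) = 0 :=
  D.eq_of_γ_of_ell (fun z ↦ by rw [γ_nabla_n, U_n_left, map_zero, zero_apply])
    (by rw [ell_nabla_n, s_n, map_zero])

/-- `£_n ℓ = 2 s`. -/
lemma ell_bracket_n (V : VField m N) (x : N) [SmoothFieldAt V x] :
    D.ell x (mlieBracket (𝓡 m) D.n V x) = act D.n (app₁ D.ell₁ V) x - 2 * D.s x (V x) := by
  have h : D.s x (V x) = _ := D.F_apply (D.diffVF_n x) (SmoothFieldAt.diffVF V x)
  have h1 : (fun y ↦ D.ell y (D.n y)) = fun _ ↦ 1 := by ext y; rw [D.ell_n]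
  rw [h1, dir_const] at h
  rw [h]
  change _ = dir (fun y ↦ D.ell y (V y)) x (D.n x) - _
  ring

end NullMetricData

/-! ### Covariant and Lie derivatives of smooth tensor fields -/

section Tensorial

variable {m : ℕ} {N : Type*} [TopologicalSpace N] [ChartedSpace (EuclideanSpace ℝ (Fin m)) N]
  [IsManifold (𝓡 m) ∞ N] (D : NullMetricData m N)

lemma app₁_smul (θ : Form1 m N) [IsSmoothForm θ] (f : N → ℝ) (V : VField m N) :
    app₁ θ (f • V) = f * app₁ θ V := by
  ext y; exact IsSmoothForm.smul y _ _

lemma app₁_add (θ : Form1 m N) [IsSmoothForm θ] (V W : VField m N) :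
    app₁ θ (V + W) = app₁ θ V + app₁ θ W := by
  ext y; exact IsSmoothForm.add y _ _

lemma app₂_smul_right (T : Tensor2 m N) [IsSmoothTensor T] (f : N → ℝ) (V W : VField m N) :
    app₂ T V (f • W) = f * app₂ T V W := by
  ext y; exact IsSmoothTensor.smul_right y _ _ _

lemma app₂_add_right (T : Tensor2 m N) [IsSmoothTensor T] (V W W' : VField m N) :
    app₂ T V (W + W') = app₂ T V W + app₂ T V W' := by
  ext y; exact IsSmoothTensor.add_right y _ _ _

/-- `∇θ` may be computed with any smooth extension of the second vector. -/
lemma covForm_nabla_apply (θ : Form1 m N) [IsSmoothForm θ] (W : VField m N) (x : N)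
    [SmoothFieldAt W x] (u : TangentSpace (𝓡 m) x) :
    covForm D.nabla θ x u (W x) = dir (app₁ θ W) x u - θ x (D.nabla W x u) := by
  refine eq_of_tensorial (Φ := fun W ↦ dir (app₁ θ W) x u - θ x (D.nabla W x u)) ?_ ?_ ?_
    (ext_self (W x))
  · intro V W _ _ h
    rw [D.nabla_congr h, dir_congr (g := app₁ θ W)]
    filter_upwards [h] with y hy
    rw [app₁, app₁, hy]
  · intro V W _ _
    rw [app₁_add, dir_fun_add, D.nabla_add, IsSmoothForm.add (θ := θ)]
    ring
  · intro f V _ _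
    rw [app₁_smul, dir_fun_mul, D.nabla_smul, IsSmoothForm.add (θ := θ),
      IsSmoothForm.smul (θ := θ), IsSmoothForm.smul (θ := θ), app₁]
    ring

/-- `£_n T` may be computed with any smooth extension of the second vector. -/
lemma lieDeriv_n_apply_right (T : Tensor2 m N) [IsSmoothTensor T] (W : VField m N) (x : N)
    [SmoothFieldAt W x] (v : TangentSpace (𝓡 m) x) :
    lieDeriv D.n T x v (W x) = act D.n (app₂ T (ext v) W) x
      - T x (mlieBracket (𝓡 m) D.n (ext v) x) (W x) - T x v (mlieBracket (𝓡 m) D.n W x) := by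
  have h := eq_of_tensorial (V := ext (W x)) (W := W)
    (Φ := fun W ↦ act D.n (app₂ T (ext v) W) x
      - T x (mlieBracket (𝓡 m) D.n (ext v) x) (W x) - T x v (mlieBracket (𝓡 m) D.n W x)) ?_ ?_ ?_
    (ext_self (W x))
  · rw [← h, ext_self]
    rfl
  · intro V W _ _ h
    rw [bracket_congr (.of_forall fun _ ↦ rfl) h, h.self_of_nhds, act, act,
      dir_congr (g := app₂ T (ext v) W)]
    filter_upwards [h] with y hy
    rw [app₂, app₂, hy]
  · intro V W _ _
    rw [app₂_add_right, act, dir_fun_add, bracket_add_right, IsSmoothTensor.add_right (T := T),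
      Pi.add_apply, IsSmoothTensor.add_right (T := T)]
    simp only [act]
    ring
  · intro f V _ _
    rw [app₂_smul_right, act, dir_fun_mul, bracket_smul_right, IsSmoothTensor.add_right (T := T),
      Pi.smul_apply', IsSmoothTensor.smul_right (T := T), IsSmoothTensor.smul_right (T := T),
      IsSmoothTensor.smul_right (T := T), app₂, ext_self]
    simp only [act]
    ring

end Tensorial

/-! ### The Lie derivative of the connection and the non-isolation tensor -/

section

variable {m : ℕ} {N : Type*} [TopologicalSpace N] [ChartedSpace (EuclideanSpace ℝ (Fin m)) N]
  [IsManifold (𝓡 m) ∞ N]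

lemma act_apply (V : VField m N) (f : N → ℝ) (x : N) : act V f x = dir f x (V x) := rfl

lemma app₂_apply (T : Tensor2 m N) (V W : VField m N) (x : N) :
    app₂ T V W x = T x (V x) (W x) := rfl

namespace NullMetricData

variable (D : NullMetricData m N)

lemma dir_ell_bracket_n (V : VField m N) (x : N) [SmoothFieldAt V x] (u : TangentSpace (𝓡 m) x) :
    dir (app₁ D.ell₁ (mlieBracket (𝓡 m) D.n V)) x u =
      dir (act D.n (app₁ D.ell₁ V)) x u - 2 * dir (app₁ D.s V) x u := by
  have h : app₁ D.ell₁ (mlieBracket (𝓡 m) D.n V) =ᶠ[𝓝 x]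
      act D.n (app₁ D.ell₁ V) - (2 : ℝ) • app₁ D.s V := by
    filter_upwards [SmoothFieldAt.eventually V x] with y _
    exact D.ell_bracket_n V y
  rw [dir_congr h, dir_fun_sub, dir_fun_smul]

lemma two_F (V W : VField m N) (x : N) [SmoothFieldAt V x] [SmoothFieldAt W x] :
    2 * D.F x (V x) (W x) = dir (app₁ D.ell₁ W) x (V x) - dir (app₁ D.ell₁ V) x (W x)
      - D.ell x (mlieBracket (𝓡 m) V W x) := by
  rw [D.F_apply (SmoothFieldAt.diffVF V x) (SmoothFieldAt.diffVF W x)]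
  change 2 * (1 / 2 * (dir (app₁ D.ell₁ W) x (V x) - dir (app₁ D.ell₁ V) x (W x) - _)) = _
  ring

/-- `£_n F = ds`, from `2 F = dℓ` and Cartan's formula. -/
lemma lie_F (V W : VField m N) (x : N) [SmoothFieldAt V x] [SmoothFieldAt W x] :
    act D.n (app₂ D.F V W) x - D.F x (mlieBracket (𝓡 m) D.n V x) (W x)
        - D.F x (V x) (mlieBracket (𝓡 m) D.n W x) =
      dir (app₁ D.s W) x (V x) - dir (app₁ D.s V) x (W x)
        - D.s x (mlieBracket (𝓡 m) V W x) := by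
  have h : app₂ D.F V W =ᶠ[𝓝 x] (1 / 2 : ℝ) • (act V (app₁ D.ell₁ W) - act W (app₁ D.ell₁ V)
      - app₁ D.ell₁ (mlieBracket (𝓡 m) V W)) := by
    filter_upwards [SmoothFieldAt.eventually V x, SmoothFieldAt.eventually W x] with y _ _
    exact D.F_apply (SmoothFieldAt.diffVF V y) (SmoothFieldAt.diffVF W y)
  have h1 := D.two_F (mlieBracket (𝓡 m) D.n V) W x
  have h2 := D.two_F V (mlieBracket (𝓡 m) D.n W) x
  rw [dir_ell_bracket_n, dir_bracket] at h1 h2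
  have h3 := D.ell_bracket_n (mlieBracket (𝓡 m) V W) x
  rw [jacobi, map_add] at h3
  rw [act_apply, dir_congr h, dir_fun_smul, dir_fun_sub, dir_fun_sub]
  simp only [act_apply] at *
  linarith

/-- The contraction of `£_n ∇` with `ℓ`, which is obtained by taking the Lie derivative of
`∇_a ℓ_b = F_{ab} - ℓ⁽²⁾ U_{ab}` along `n`. -/
lemma ell_lieConnection_n (V W : VField m N) (x : N) [SmoothFieldAt V x] [SmoothFieldAt W x] :
    D.ell x (mlieBracket (𝓡 m) D.n (D.cov V W) x)
        - D.ell x (D.nabla (mlieBracket (𝓡 m) D.n W) x (V x))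
        - D.ell x (D.nabla W x (mlieBracket (𝓡 m) D.n V x)) =
      dir (app₁ D.s W) x (V x) - D.s x (D.nabla W x (V x))
        + (dir (app₁ D.s V) x (W x) - D.s x (D.nabla V x (W x)))
        + dir D.ell2 x (D.n x) * D.U x (V x) (W x)
        + D.ell2 x * (act D.n (app₂ D.U V W) x - D.U x (mlieBracket (𝓡 m) D.n V x) (W x)
          - D.U x (V x) (mlieBracket (𝓡 m) D.n W x)) := by
  have h1 := D.ell_bracket_n (D.cov V W) x
  have h2 : app₁ D.ell₁ (D.cov V W) =ᶠ[𝓝 x]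
      act V (app₁ D.ell₁ W) - app₂ D.F V W + D.ell2 * app₂ D.U V W := by
    filter_upwards [SmoothFieldAt.eventually V x, SmoothFieldAt.eventually W x] with y _ _
    exact D.app₁_ell_cov V W y
  rw [act_apply, dir_congr h2, dir_fun_add, dir_fun_sub, dir_fun_mul] at h1
  have h3 := D.dir_ell (mlieBracket (𝓡 m) D.n W) x (V x)
  rw [dir_ell_bracket_n] at h3
  have h5 := D.dir_ell W x (mlieBracket (𝓡 m) D.n V x)
  rw [dir_bracket] at h5
  have h7 := D.lie_F V W x
  rw [D.bracket_eq V W, IsSmoothForm.sub D.s] at h7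
  simp only [act_apply, app₂_apply, cov] at *
  linarith

end NullMetricData

end

namespace KTuple

variable {m : ℕ} {N : Type*} [TopologicalSpace N] [ChartedSpace (EuclideanSpace ℝ (Fin m)) N]
  [IsManifold (𝓡 m) ∞ N] (K : KTuple m N)

instance (x : N) : SmoothFunAt (m := m) K.α x := ⟨.of_forall K.smooth_α⟩

instance : IsSmoothForm K.r := inferInstanceAs (IsSmoothForm fun x v ↦ K.Y₂ x (K.n x) v)

instance : IsSmoothForm K.om where
  add _ _ _ := by simp only [om, IsSmoothForm.add (θ := K.s), IsSmoothForm.add (θ := K.r)]; ring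
  smul _ _ _ := by simp only [om, IsSmoothForm.smul (θ := K.s), IsSmoothForm.smul (θ := K.r)]; ring
  smooth V x _ := inferInstanceAs (SmoothFunAt (m := m) (app₁ K.s V - app₁ K.r V) x)

instance : IsSmoothForm K.dα where
  add _ _ _ := dir_vadd ..
  smul _ _ _ := dir_vsmul ..
  smooth V x _ := inferInstanceAs (SmoothFunAt (m := m) (act V K.α) x)

lemma η_eq : K.η = K.α • K.n := rfl

lemma bracket_η (V : VField m N) (x : N) : mlieBracket (𝓡 m) K.η V x =
    K.α x • mlieBracket (𝓡 m) K.n V x - dir K.α x (V x) • K.n x := by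
  rw [η_eq, bracket_smul_left, act_apply, neg_smul]
  abel

/-- The non-isolation tensor in terms of `∇∇α`, `£_n Y` and first derivatives of `s`. The terms with
`ℓ⁽²⁾ £_n U` in its definition cancel the corresponding term of `ℓ(£_n ∇)`. -/
theorem Pi_eq (x : N) (v w : TangentSpace (𝓡 m) x) :
    K.Pi x v w = covForm K.nabla K.dα x v w + (K.om x v * K.dα x w + K.om x w * K.dα x v)
      - K.α x * lieDeriv K.n K.Y₂ x v w + dir K.α x (K.n x) * K.Y x v w
      + K.α x * (covForm K.nabla K.s x v w + covForm K.nabla K.s x w v)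
      + 1 / 2 * (K.α x * dir K.ell2 x (K.n x) + K.p x) * K.U x v w := by
  set V : VField m N := ext v
  set W : VField m N := ext w
  have hVx : V x = v := ext_self v
  have hWx : W x = w := ext_self w
  have h1 : (fun y ↦ K.nablaBar W y (V y)) = K.cov V W - app₂ K.Y₂ V W • K.n := by
    ext1 y; exact K.nablaBar_apply W y (V y)
  have h2 : ∀ᶠ y in 𝓝 x, (K.α • mlieBracket (𝓡 m) K.n W - act W K.α • K.n) y =
      mlieBracket (𝓡 m) K.η W y := by
    filter_upwards with y
    exact (K.bracket_η W y).symm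
  have hS : K.Sigma x v w = mlieBracket (𝓡 m) K.η (fun y ↦ K.nablaBar W y (V y)) x
    - K.nablaBar (mlieBracket (𝓡 m) K.η W) x v
    - K.nablaBar W x (mlieBracket (𝓡 m) K.η V x) := rfl
  rw [h1, K.nablaBar_apply, K.nablaBar_apply, ← K.nabla_congr h2, K.nabla_sub, K.nabla_smul,
    K.nabla_smul, K.bracket_η, K.bracket_η, K.bracket_η, bracket_sub_right, bracket_smul_right,
    mlieBracket_self, Pi.zero_apply] at hS
  have h3 := K.ell_lieConnection_n V W x
  have h4 := K.bracket_eq K.n W x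
  have h5 := congr_arg (K.ell x) h4
  rw [map_sub, NullMetricData.cov, NullMetricData.cov, K.ell_nabla_n] at h5
  have hY : lieDeriv K.n K.Y₂ x v w = act K.n (app₂ K.Y₂ V W) x
    - K.Y x (mlieBracket (𝓡 m) K.n V x) w - K.Y x v (mlieBracket (𝓡 m) K.n W x) := rfl
  have hU : lieDeriv K.n K.U x v w = act K.n (app₂ K.U V W) x
    - K.U x (mlieBracket (𝓡 m) K.n V x) w - K.U x v (mlieBracket (𝓡 m) K.n W x) := rfl
  have hα : covForm K.nabla K.dα x v w = dir (act W K.α) x v - dir K.α x (K.nabla W x v) := rfl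
  have hs1 : covForm K.nabla K.s x v w = dir (app₁ K.s W) x v - K.s x (K.nabla W x v) := rfl
  have hs2 : covForm K.nabla K.s x w v = dir (app₁ K.s V) x w - K.s x (K.nabla V x w) := rfl
  rw [Pi, hS, hY, hU, hα, hs1, hs2]
  simp only [hVx, hWx, Pi.sub_apply, Pi.smul_apply', map_sub, map_add, map_smul, smul_eq_mul,
    K.ell_n, K.ell_nabla_n, dir_vsub, dir_vsmul, act_apply, sub_apply, smul_apply,
    smul_zero, add_zero, NullMetricData.cov, app₂_apply, om, r, dα, Y₂] at *
  simp only [K.symm_Y x v (K.n x)]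
  linear_combination K.α x * h3 - dir K.α x v * h5

end KTuple

/-! ### Traces -/

section Trace

variable {m : ℕ} {N : Type*} [TopologicalSpace N] [ChartedSpace (EuclideanSpace ℝ (Fin m)) N]
  [IsManifold (𝓡 m) ∞ N]

lemma co_sub {x : N} (v w : TangentSpace (𝓡 m) x) (a : Fin m) : co (v - w) a = co v a - co w a :=
  rfl

lemma co_neg {x : N} (v : TangentSpace (𝓡 m) x) (a : Fin m) : co (-v) a = -co v a := rfl

lemma co_sum {x : N} {ι : Type*} (t : Finset ι) (v : ι → TangentSpace (𝓡 m) x) (a : Fin m) :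
    co (∑ i ∈ t, v i) a = ∑ i ∈ t, co (v i) a := by
  classical
  induction t using Finset.induction_on with
  | empty => rfl
  | insert a t ha ih => rw [Finset.sum_insert ha, Finset.sum_insert ha, co_add, ih]

lemma sum_co_mul {x : N} (θ : TangentSpace (𝓡 m) x →ₗ[ℝ] ℝ) (v : TangentSpace (𝓡 m) x) :
    ∑ a, co v a * θ (e x a) = θ v := by
  conv_rhs => rw [← sum_co_smul_e v]
  simp

lemma sum_co_eq_trace (y : N) (C : TangentSpace (𝓡 m) y →ₗ[ℝ] TangentSpace (𝓡 m) y) :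
    ∑ a, co (C (e y a)) a = LinearMap.trace ℝ (TangentSpace (𝓡 m) y) C := by
  have h := LinearMap.trace_eq_matrix_trace ℝ (M := EuclideanSpace ℝ (Fin m))
    (EuclideanSpace.basisFun (Fin m) ℝ).toBasis C
  refine Eq.trans ?_ h.symm
  simp [Matrix.trace, co, e]
  rfl

lemma sum_frameCo_eq_trace {x y : N} (hy : y ∈ (triv (m := m) x).baseSet)
    (C : TangentSpace (𝓡 m) y →ₗ[ℝ] TangentSpace (𝓡 m) y) :
    ∑ a, (triv (m := m) x).localFrameCoeff (𝓡 m) (EuclideanSpace.basisFun (Fin m) ℝ).toBasis a y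
      (C (ext (e x a) y)) = LinearMap.trace ℝ (TangentSpace (𝓡 m) y) C := by
  rw [LinearMap.trace_eq_matrix_trace ℝ
    ((triv (m := m) x).basisAt (EuclideanSpace.basisFun (Fin m) ℝ).toBasis hy) C, Matrix.trace]
  refine Finset.sum_congr rfl fun a _ ↦ ?_
  rw [Matrix.diag_apply, LinearMap.toMatrix_apply, ext_e_apply hy]
  have h := (triv (m := m) x).localFrameCoeff_apply_of_mem_baseSet (I := 𝓡 m)
    (EuclideanSpace.basisFun (Fin m) ℝ).toBasis hy (ext (C ((triv (m := m) x).basisAt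
      (EuclideanSpace.basisFun (Fin m) ℝ).toBasis hy a))) a
  rwa [ext_self] at h

instance {ι : Type*} (t : Finset ι) (V : ι → VField m N) (x : N) [∀ i, SmoothFieldAt (V i) x] :
    SmoothFieldAt (∑ i ∈ t, V i) x := by
  classical
  induction t using Finset.induction_on with
  | empty =>
    have h : SmoothFieldAt ((fun _ : N ↦ (0 : ℝ)) • ext (0 : TangentSpace (𝓡 m) x)) x :=
      inferInstance
    exact h.congr (.of_forall fun y ↦ by simp)
  | insert a t ha ih => rw [Finset.sum_insert ha]; infer_instance

instance {ι : Type*} (t : Finset ι) (f : ι → N → ℝ) (x : N)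
    [∀ i, SmoothFunAt (m := m) (f i) x] : SmoothFunAt (m := m) (∑ i ∈ t, f i) x := by
  classical
  induction t using Finset.induction_on with
  | empty => exact inferInstanceAs (SmoothFunAt (m := m) (fun _ ↦ (0 : ℝ)) x)
  | insert a t ha ih => rw [Finset.sum_insert ha]; infer_instance

lemma dir_fun_sum {ι : Type*} (t : Finset ι) (f : ι → N → ℝ) (x : N)
    [∀ i, SmoothFunAt (m := m) (f i) x] (v : TangentSpace (𝓡 m) x) :
    dir (∑ i ∈ t, f i) x v = ∑ i ∈ t, dir (f i) x v := by
  classical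
  induction t using Finset.induction_on with
  | empty => exact dir_const 0 x v
  | insert a t ha ih => rw [Finset.sum_insert ha, Finset.sum_insert ha, dir_fun_add, ih]

namespace NullMetricData

variable (D : NullMetricData m N)

lemma nabla_sum {ι : Type*} (t : Finset ι) (V : ι → VField m N) (x : N)
    [∀ i, SmoothFieldAt (V i) x] (u : TangentSpace (𝓡 m) x) :
    D.nabla (∑ i ∈ t, V i) x u = ∑ i ∈ t, D.nabla (V i) x u := by
  classical
  induction t using Finset.induction_on with
  | empty => simp
  | insert a t ha ih => rw [Finset.sum_insert ha, Finset.sum_insert ha, nabla_add, ih]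

/-- The components of `∇_u V` in the frame `ext (e x a)`. -/
lemma co_nabla (V : VField m N) (x : N) [SmoothFieldAt V x] (u : TangentSpace (𝓡 m) x)
    (a : Fin m) : co (D.nabla V x u) a = dir (frameCo x V a) x u +
      ∑ b, co (V x) b * co (D.nabla (ext (e x b)) x u) a := by
  have h : D.nabla V x u = ∑ b, (co (V x) b • D.nabla (ext (e x b)) x u +
      dir (frameCo x V b) x u • e x b) := by
    rw [D.nabla_congr (frame_expansion x V), nabla_sum]
    refine Finset.sum_congr rfl fun b _ ↦ ?_
    rw [nabla_smul, frameCo_self, ext_self]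
  rw [h, Finset.sum_add_distrib, co_add, co_sum_smul_e, add_comm]
  simp only [co_sum, co_smul]

/-- The derivative of the trace of an endomorphism field `B` is the trace of `∇B`. -/
lemma dir_trace (B : Π y : N, TangentSpace (𝓡 m) y →L[ℝ] TangentSpace (𝓡 m) y) (x : N)
    (hB : ∀ V : VField m N, [SmoothFieldAt V x] → SmoothFieldAt (fun y ↦ B y (V y)) x)
    (u : TangentSpace (𝓡 m) x) :
    dir (fun y ↦ ∑ a, co (B y (e y a)) a) x u =
      ∑ a, co (D.nabla (fun y ↦ B y (ext (e x a) y)) x u - B x (D.nabla (ext (e x a)) x u)) a := by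
  have h : (fun y ↦ ∑ a, co (B y (e y a)) a) =ᶠ[𝓝 x]
      ∑ a, frameCo x (fun y ↦ B y (ext (e x a) y)) a := by
    filter_upwards [mem_baseSet (m := m) x] with y hy
    rw [Finset.sum_apply]
    exact (sum_co_eq_trace y (B y).toLinearMap).trans
      (sum_frameCo_eq_trace hy (B y).toLinearMap).symm
  rw [dir_congr h, dir_fun_sum]
  simp only [co_sub, Finset.sum_sub_distrib, D.co_nabla (fun y ↦ B y (ext (e x _) y)),
    Finset.sum_add_distrib, ext_self]
  have h2 : ∀ a, co (B x (D.nabla (ext (e x a)) x u)) a =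
      ∑ b, co (B x (e x b)) a * co (D.nabla (ext (e x a)) x u) b := by
    intro a
    conv_lhs => rw [← sum_co_smul_e (D.nabla (ext (e x a)) x u), map_sum]
    rw [co_sum]
    refine Finset.sum_congr rfl fun b _ ↦ ?_
    rw [map_smul, co_smul, mul_comm]
  simp only [h2]
  rw [Finset.sum_comm (f := fun a b ↦ co (B x (e x b)) a * co (D.nabla (ext (e x a)) x u) b)]
  ring

/-- The trace of an endomorphism with columns `C_a`, by `δ^a_b = P^{ac} γ_{cb} + n^a ℓ_b`. -/
lemma sum_co_eq (x : N) (C : Fin m → TangentSpace (𝓡 m) x) :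
    ∑ a, co (C a) a = ∑ a, ∑ b, D.P x a b * D.γ x (C a) (e x b)
      + ∑ a, co (D.n x) a * D.ell x (C a) := by
  rw [← Finset.sum_add_distrib]
  refine Finset.sum_congr rfl fun a _ ↦ ?_
  have h1 : ∀ b, D.γ x (C a) (e x b) = ∑ c, co (C a) c * D.γ x (e x b) (e x c) := fun b ↦ by
    rw [D.symm_γ, D.γ_apply_co]
  simp only [h1, D.ell_apply_co x (C a), Finset.mul_sum]
  rw [Finset.sum_comm, ← Finset.sum_add_distrib]
  have h2 : ∀ c, ∑ b, D.P x a b * (co (C a) c * D.γ x (e x b) (e x c)) +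
      co (D.n x) a * (co (C a) c * D.ell x (e x c)) = co (C a) c * if a = c then 1 else 0 := by
    intro c
    rw [← D.P_γ x a c, mul_add, Finset.mul_sum]
    congr 1
    · exact Finset.sum_congr rfl fun b _ ↦ by ring
    · ring
  simp [h2]

lemma sum_P_mul (x : N) (φ : Fin m → ℝ) (θ : TangentSpace (𝓡 m) x →ₗ[ℝ] ℝ) :
    ∑ a, ∑ b, D.P x a b * (φ b * θ (e x a)) = θ (D.raise x φ 0) := by
  simp only [raise, map_sum, map_smul, zero_mul, add_zero, smul_eq_mul, Finset.sum_mul]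
  exact Finset.sum_congr rfl fun a _ ↦ Finset.sum_congr rfl fun b _ ↦ by ring

/-- `P^{ab} ℓ_a θ_b = - ℓ⁽²⁾ θ(n)`. -/
lemma sum_P_ell (x : N) (θ : Fin m → ℝ) :
    ∑ a, ∑ b, D.P x a b * (D.ell x (e x a) * θ b) = -D.ell2 x * ∑ b, co (D.n x) b * θ b := by
  rw [Finset.sum_comm, Finset.mul_sum]
  refine Finset.sum_congr rfl fun b _ ↦ ?_
  have h := D.P_ell x b
  have h1 : ∑ a, D.P x a b * (D.ell x (e x a) * θ b) =
      (∑ a, D.P x b a * D.ell x (e x a)) * θ b := by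
    rw [Finset.sum_mul]
    exact Finset.sum_congr rfl fun a _ ↦ by rw [D.P_symm x a b]; ring
  rw [h1]
  linear_combination θ b * h

/-- `U` with the first index fixed, as a linear map. -/
noncomputable def Uₗ (x : N) (v : TangentSpace (𝓡 m) x) : TangentSpace (𝓡 m) x →ₗ[ℝ] ℝ where
  toFun := D.U x v
  map_add' := D.U_add_right x v
  map_smul' c w := D.U_smul_right x c v w

/-- `F` with the first index fixed, as a linear map. -/
noncomputable def Fₗ (x : N) (v : TangentSpace (𝓡 m) x) : TangentSpace (𝓡 m) x →ₗ[ℝ] ℝ where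
  toFun := D.F x v
  map_add' := D.F_add_right x v
  map_smul' c w := D.F_smul_right x c v w

/-- `∇_a n^c = s_a n^c + P^{cb} U_{ab}`. -/
lemma raise_U (x : N) (v : TangentSpace (𝓡 m) x) :
    D.raise x (fun b ↦ D.U x v (e x b)) 0 = D.nabla D.n x v - D.s x v • D.n x := by
  have h : ∀ z, ∑ b, co z b * D.U x v (e x b) = D.U x v z := sum_co_mul (D.Uₗ x v)
  refine D.eq_of_γ_of_ell (fun z ↦ ?_) ?_
  · rw [γ_raise, h, h, U_n_right, map_sub, map_smul, sub_apply, smul_apply, γ_nabla_n, γ_n]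
    simp
  · rw [ell_raise, h, U_n_right, map_sub, map_smul, ell_nabla_n, ell_n]
    simp

/-- `P^{ab} U_{vb} θ_a = θ(∇_v n) - s(v) θ(n)`. -/
lemma sum_P_U (x : N) (v : TangentSpace (𝓡 m) x) (θ : TangentSpace (𝓡 m) x →ₗ[ℝ] ℝ) :
    ∑ a, ∑ b, D.P x a b * (D.U x v (e x b) * θ (e x a)) =
      θ (D.nabla D.n x v) - D.s x v * θ (D.n x) := by
  rw [sum_P_mul, raise_U, map_sub, map_smul, smul_eq_mul]

/-- `tr_P U` is the trace of `∇n`. -/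
lemma trP_U : D.trP D.U = fun y ↦ ∑ a, co (D.nabla D.n y (e y a)) a := by
  ext1 y
  rw [D.sum_co_eq y fun a ↦ D.nabla D.n y (e y a)]
  have h : ∑ a, co (D.n y) a * D.ell y (D.nabla D.n y (e y a)) = D.ell y (D.nabla D.n y (D.n y)) :=
    sum_co_mul ((D.ell y).toLinearMap ∘ₗ (D.nabla D.n y).toLinearMap) (D.n y)
  rw [h, nabla_n_n, map_zero, add_zero]
  simp only [γ_nabla_n]
  rfl

end NullMetricData

end Trace

/-! ### Curvature of the metric hypersurface connection -/

namespace NullMetricData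

variable {m : ℕ} {N : Type*} [TopologicalSpace N] [ChartedSpace (EuclideanSpace ℝ (Fin m)) N]
  [IsManifold (𝓡 m) ∞ N] (D : NullMetricData m N)

/-- The curvature `R(U, V) W` of the metric hypersurface connection on vector fields. -/
noncomputable def curv (U V W : VField m N) (x : N) : TangentSpace (𝓡 m) x :=
  D.nabla (D.cov V W) x (U x) - D.nabla (D.cov U W) x (V x)
    - D.nabla W x (mlieBracket (𝓡 m) U V x)

lemma curvature_eq (x : N) (u v w : TangentSpace (𝓡 m) x) :
    curvature D.nabla x u v w = D.curv (ext u) (ext v) (ext w) x := by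
  simp only [curv, ext_self]
  rfl

lemma cov_add (V W W' : VField m N) (x : N) [SmoothFieldAt W x] [SmoothFieldAt W' x] :
    D.cov V (W + W') x = D.cov V W x + D.cov V W' x := D.nabla_add ..

lemma cov_smul (V W : VField m N) (f : N → ℝ) (x : N) [SmoothFunAt (m := m) f x]
    [SmoothFieldAt W x] : D.cov V (f • W) x = f x • D.cov V W x + act V f x • W x :=
  D.nabla_smul ..

variable (U V : VField m N) (x : N) [SmoothFieldAt U x] [SmoothFieldAt V x]

lemma curv_congr (W W' : VField m N) [SmoothFieldAt W x] [SmoothFieldAt W' x]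
    (h : ∀ᶠ y in 𝓝 x, W y = W' y) : D.curv U V W x = D.curv U V W' x := by
  have key : ∀ A : VField m N, [SmoothFieldAt A x] →
      D.nabla (D.cov A W) x = D.nabla (D.cov A W') x := by
    intro A _
    refine D.nabla_congr ?_
    filter_upwards [h.eventually_nhds, SmoothFieldAt.eventually W x] with y hy _
    rw [cov, D.nabla_congr hy, cov]
  rw [curv, key V, key U, D.nabla_congr h, curv]

lemma curv_add (W W' : VField m N) [SmoothFieldAt W x] [SmoothFieldAt W' x] :
    D.curv U V (W + W') x = D.curv U V W x + D.curv U V W' x := by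
  have key : ∀ (A : VField m N) (u : TangentSpace (𝓡 m) x), [SmoothFieldAt A x] →
      D.nabla (D.cov A (W + W')) x u = D.nabla (D.cov A W) x u + D.nabla (D.cov A W') x u := by
    intro A u _
    rw [← nabla_add]
    refine DFunLike.congr_fun (D.nabla_congr ?_) u
    filter_upwards [SmoothFieldAt.eventually W x, SmoothFieldAt.eventually W' x] with y _ _
    exact D.cov_add A W W' y
  rw [curv, key V, key U, nabla_add, curv, curv]
  abel

lemma curv_smul (f : N → ℝ) (W : VField m N) [SmoothFunAt (m := m) f x] [SmoothFieldAt W x] :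
    D.curv U V (f • W) x = f x • D.curv U V W x := by
  have key : ∀ (A : VField m N) (u : TangentSpace (𝓡 m) x), [SmoothFieldAt A x] →
      D.nabla (D.cov A (f • W)) x u = f x • D.nabla (D.cov A W) x u + dir f x u • D.cov A W x
        + (act A f x • D.nabla W x u + dir (act A f) x u • W x) := by
    intro A u _
    rw [← nabla_smul, ← nabla_smul, ← nabla_add]
    refine DFunLike.congr_fun (D.nabla_congr ?_) u
    filter_upwards [SmoothFieldAt.eventually W x, SmoothFunAt.eventually (m := m) f x] with y _ _
    exact D.cov_smul A W f y
  have h := dir_bracket U V f x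
  rw [curv, key V, key U, nabla_smul, h, curv]
  simp only [cov, act]
  module

/-- The curvature `R(U, V) W` at `x` depends only on the value of `W` at `x`. -/
lemma curv_eq_of_eq (W W' : VField m N) [SmoothFieldAt W x] [SmoothFieldAt W' x]
    (h : W x = W' x) : D.curv U V W x = D.curv U V W' x := by
  refine ext_of_co fun a ↦ eq_of_tensorial (Φ := fun W ↦ co (D.curv U V W x) a) ?_ ?_ ?_ h
  · intro W W' _ _ h
    rw [D.curv_congr U V x W W' h]
  · intro W W' _ _
    rw [D.curv_add U V x W W', co_add]
  · intro f W _ _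
    rw [D.curv_smul U V x f W, co_smul]

lemma ell_curv_eq_sum (W : VField m N) [SmoothFieldAt W x] :
    D.ell x (D.curv U V W x) = ∑ a, co (W x) a * D.ell x (D.curv U V (ext (e x a)) x) := by
  refine tensorial_expansion (Φ := fun W ↦ D.ell x (D.curv U V W x)) ?_ ?_ ?_ W
  · intro W W' _ _ h
    rw [D.curv_congr U V x W W' h]
  · intro W W' _ _
    rw [D.curv_add U V x W W', map_add]
  · intro f W _ _
    rw [D.curv_smul U V x f W, map_smul, smul_eq_mul]

lemma curv_swap (W : VField m N) : D.curv V U W x = -D.curv U V W x := by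
  rw [curv, curv, mlieBracket_swap_apply, map_neg]
  abel

/-- The first Bianchi identity, from the Jacobi identity and the vanishing of the torsion. -/
lemma bianchi (W : VField m N) [SmoothFieldAt W x] :
    D.curv U V W x + D.curv V W U x + D.curv W U V x = 0 := by
  have key : ∀ A B C : VField m N, [SmoothFieldAt A x] → [SmoothFieldAt B x] →
      [SmoothFieldAt C x] → D.nabla (D.cov B C) x (A x) - D.nabla (D.cov C B) x (A x) =
        mlieBracket (𝓡 m) A (mlieBracket (𝓡 m) B C) x
          + D.nabla A x (mlieBracket (𝓡 m) B C x) := by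
    intro A B C _ _ _
    have h : ∀ᶠ y in 𝓝 x, mlieBracket (𝓡 m) B C y = (D.cov B C - D.cov C B) y := by
      filter_upwards [SmoothFieldAt.eventually B x, SmoothFieldAt.eventually C x] with y _ _
      exact D.bracket_eq B C y
    rw [← nabla_sub, ← D.nabla_congr h, D.bracket_eq A]
    simp only [cov]
    abel
  have h1 := key U V W
  have h2 := key V W U
  have h3 := key W U V
  have h4 := jacobi U V W x
  rw [mlieBracket_swap_apply (V := mlieBracket (𝓡 m) U V), mlieBracket_swap (V := U) (W := W)] at h4
  have h5 : mlieBracket (𝓡 m) V (-mlieBracket (𝓡 m) W U) x =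
      -mlieBracket (𝓡 m) V (mlieBracket (𝓡 m) W U) x := by
    rw [mlieBracket_swap_apply, mlieBracket_swap_apply (V := V) (W := mlieBracket (𝓡 m) W U)]
    have h6 : -mlieBracket (𝓡 m) W U = (fun _ : N ↦ (-1 : ℝ)) • mlieBracket (𝓡 m) W U := by
      ext1 y; simp
    rw [h6, bracket_smul_left]
    simp [act, dir_const]
  rw [h5] at h4
  have h7 : D.curv U V W x + D.curv V W U x + D.curv W U V x =
      (D.nabla (D.cov V W) x (U x) - D.nabla (D.cov W V) x (U x))
      + (D.nabla (D.cov W U) x (V x) - D.nabla (D.cov U W) x (V x))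
      + (D.nabla (D.cov U V) x (W x) - D.nabla (D.cov V U) x (W x))
      - D.nabla W x (mlieBracket (𝓡 m) U V x) - D.nabla U x (mlieBracket (𝓡 m) V W x)
      - D.nabla V x (mlieBracket (𝓡 m) W U x) := by
    simp only [curv]
    abel
  rw [h7, h1, h2, h3, h4]
  abel

/-- `(∇_u A)(V)` for the endomorphism field `A = ∇n`. -/
noncomputable def nablaA (V : VField m N) (x : N) (u : TangentSpace (𝓡 m) x) :
    TangentSpace (𝓡 m) x :=
  D.nabla (D.cov V D.n) x u - D.nabla D.n x (D.nabla V x u)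

/-- The Ricci identity for `n`. -/
lemma curv_n : D.curv U V D.n x = D.nablaA V x (U x) - D.nablaA U x (V x) := by
  rw [curv, D.bracket_eq, map_sub, nablaA, nablaA, cov, cov]
  abel

omit [SmoothFieldAt U x] in
lemma γ_nablaA (u w : TangentSpace (𝓡 m) x) :
    D.γ x (D.nablaA V x u) w = dir (app₂ D.U V (ext w)) x u - D.U x (D.nabla V x u) w
      - D.U x (V x) (D.nabla (ext w) x u) + D.s x (V x) * D.U x u w
      + D.ell x w * D.U x u (D.nabla D.n x (V x)) := by
  have h := D.dir_γ (D.cov V D.n) (ext w) x u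
  have h1 : app₂ D.γ₂ (D.cov V D.n) (ext w) = app₂ D.U V (ext w) := by
    ext y; exact D.γ_nabla_n y _ _
  rw [h1, cov, γ_nabla_n, ell_nabla_n, ext_self] at h
  rw [nablaA, map_sub, sub_apply, γ_nabla_n]
  change dir _ x u = D.γ x (D.nabla (D.cov V D.n) x u) w + _ - _ - _ at h
  linarith

lemma ell_nablaA (u : TangentSpace (𝓡 m) x) :
    D.ell x (D.nablaA V x u) = dir (app₁ D.s V) x u - D.s x (D.nabla V x u)
      - D.F x u (D.nabla D.n x (V x)) + D.ell2 x * D.U x u (D.nabla D.n x (V x)) := by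
  have h := D.dir_ell (D.cov V D.n) x u
  have h1 : app₁ D.ell₁ (D.cov V D.n) = app₁ D.s V := by
    ext y; exact D.ell_nabla_n y _
  rw [h1] at h
  rw [nablaA, map_sub, ell_nabla_n]
  change dir _ x u = _ + D.F x u (D.nabla D.n x (V x)) - _ * D.U x u (D.nabla D.n x (V x)) at h
  linarith

lemma U_nabla_n_comm (v w : TangentSpace (𝓡 m) x) :
    D.U x v (D.nabla D.n x w) = D.U x w (D.nabla D.n x v) := by
  rw [← γ_nabla_n, ← γ_nabla_n, D.symm_γ]

/-- The antisymmetric part of `(∇_U U)(V, Z)` in `U`, `V`. -/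
noncomputable def dU (U V Z : VField m N) (x : N) : ℝ :=
  (dir (app₂ D.U V Z) x (U x) - D.U x (V x) (D.nabla Z x (U x)))
    - (dir (app₂ D.U U Z) x (V x) - D.U x (U x) (D.nabla Z x (V x)))
    - D.U x (mlieBracket (𝓡 m) U V x) (Z x)

lemma dU_eq_sum (Z : VField m N) [SmoothFieldAt Z x] :
    D.dU U V Z x = ∑ a, co (Z x) a * D.dU U V (ext (e x a)) x := by
  refine tensorial_expansion (Φ := fun Z ↦ D.dU U V Z x) ?_ ?_ ?_ Z
  · intro Z Z' _ _ h
    have h1 : ∀ A : VField m N, app₂ D.U A Z =ᶠ[𝓝 x] app₂ D.U A Z' := fun A ↦ by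
      filter_upwards [h] with y hy
      rw [app₂, app₂, hy]
    rw [dU, dir_congr (h1 V), dir_congr (h1 U), D.nabla_congr h, h.self_of_nhds, dU]
  · intro Z Z' _ _
    rw [dU, app₂_add_right, app₂_add_right, dir_fun_add, dir_fun_add, nabla_add, nabla_add,
      Pi.add_apply, U_add_right, U_add_right, U_add_right, dU, dU]
    ring
  · intro f Z _ _
    rw [dU, app₂_smul_right, app₂_smul_right, dir_fun_mul, dir_fun_mul, nabla_smul, nabla_smul,
      Pi.smul_apply', U_add_right, U_add_right, U_smul_right, U_smul_right, U_smul_right,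
      U_smul_right, U_smul_right, dU, app₂, app₂]
    ring

lemma dU_n : D.dU U V D.n x = 0 := by
  have h : ∀ A : VField m N, app₂ D.U A D.n = fun _ ↦ 0 := fun A ↦ by
    ext y; exact D.U_n_right y _
  rw [dU, h, h, dir_const, dir_const, U_n_right, U_nabla_n_comm]
  ring

lemma dir_app₂_γ (W Y Z : VField m N) [SmoothFieldAt W x] [SmoothFieldAt Y x] [SmoothFieldAt Z x]
    (u : TangentSpace (𝓡 m) x) :
    dir (act W (app₂ D.γ₂ Y Z)) x u = dir (app₂ D.γ₂ (D.cov W Y) Z) x u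
      + dir (app₂ D.γ₂ Y (D.cov W Z)) x u
      - (D.ell x (Y x) * dir (app₂ D.U W Z) x u + D.U x (W x) (Z x) * dir (app₁ D.ell₁ Y) x u)
      - (D.ell x (Z x) * dir (app₂ D.U W Y) x u + D.U x (W x) (Y x) * dir (app₁ D.ell₁ Z) x u) := by
  have h : act W (app₂ D.γ₂ Y Z) =ᶠ[𝓝 x] app₂ D.γ₂ (D.cov W Y) Z + app₂ D.γ₂ Y (D.cov W Z)
      - app₁ D.ell₁ Y * app₂ D.U W Z - app₁ D.ell₁ Z * app₂ D.U W Y := by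
    filter_upwards [SmoothFieldAt.eventually Y x, SmoothFieldAt.eventually Z x] with y _ _
    exact D.dir_γ Y Z y (W y)
  rw [dir_congr h, dir_fun_sub, dir_fun_sub, dir_fun_add, dir_fun_mul, dir_fun_mul]
  rfl

/-- The Ricci identity for `γ`. -/
lemma γ_curv (Y Z : VField m N) [SmoothFieldAt Y x] [SmoothFieldAt Z x] :
    D.γ x (D.curv U V Y x) (Z x) + D.γ x (Y x) (D.curv U V Z x) =
      D.ell x (Y x) * D.dU U V Z x + D.ell x (Z x) * D.dU U V Y x
      + D.U x (V x) (Z x) * D.F x (U x) (Y x) - D.U x (U x) (Z x) * D.F x (V x) (Y x)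
      + D.U x (V x) (Y x) * D.F x (U x) (Z x) - D.U x (U x) (Y x) * D.F x (V x) (Z x) := by
  have h0 := dir_bracket U V (app₂ D.γ₂ Y Z) x
  rw [act_apply U, act_apply V, dir_app₂_γ, dir_app₂_γ] at h0
  simp only [D.dir_γ, D.dir_ell] at h0
  simp only [curv, dU, cov, map_sub, sub_apply] at h0 ⊢
  linear_combination -h0

/-- The trace of the curvature endomorphism `R(U, V)` is `ds(U, V)`. -/
lemma sum_co_curv :
    ∑ a, co (D.curv U V (ext (e x a)) x) a =
      (dir (app₁ D.s V) x (U x) - D.s x (D.nabla V x (U x)))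
        - (dir (app₁ D.s U) x (V x) - D.s x (D.nabla U x (V x))) := by
  rw [D.sum_co_eq x fun a ↦ D.curv U V (ext (e x a)) x, ← D.ell_curv_eq_sum U V x D.n, curv_n,
    map_sub, ell_nablaA, ell_nablaA, U_nabla_n_comm]
  -- The trace of `γ(R(U, V) ·, ·)` with the symmetric tensor `P` sees the symmetric part only.
  have h1 : 2 * ∑ a, ∑ b, D.P x a b * D.γ x (D.curv U V (ext (e x a)) x) (e x b) =
      ∑ a, ∑ b, D.P x a b * (D.γ x (D.curv U V (ext (e x a)) x) (e x b)
        + D.γ x (e x a) (D.curv U V (ext (e x b)) x)) := by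
    simp only [mul_add, Finset.sum_add_distrib]
    rw [two_mul]
    congr 1
    rw [Finset.sum_comm]
    exact Finset.sum_congr rfl fun a _ ↦ Finset.sum_congr rfl fun b _ ↦ by
      rw [D.P_symm, D.symm_γ]
  have h2 : ∀ a b, D.γ x (D.curv U V (ext (e x a)) x) (e x b)
        + D.γ x (e x a) (D.curv U V (ext (e x b)) x) = _ := fun a b ↦ by
    have := D.γ_curv U V x (ext (e x a)) (ext (e x b))
    simp only [ext_self] at this
    exact this
  simp only [h2, mul_add, mul_sub, Finset.sum_add_distrib, Finset.sum_sub_distrib] at h1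
  have hswap : ∀ f : Fin m → Fin m → ℝ, ∑ a, ∑ b, D.P x a b * f b a =
      ∑ a, ∑ b, D.P x a b * f a b := by
    intro f
    rw [Finset.sum_comm]
    exact Finset.sum_congr rfl fun a _ ↦ Finset.sum_congr rfl fun b _ ↦ by rw [D.P_symm]
  rw [hswap fun a b ↦ D.ell x (e x a) * D.dU U V (ext (e x b)) x, D.sum_P_ell x,
    ← D.dU_eq_sum U V x D.n, dU_n,
    hswap fun b a ↦ D.U x (V x) (e x b) * D.F x (U x) (e x a),
    hswap fun b a ↦ D.U x (U x) (e x b) * D.F x (V x) (e x a)] at h1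
  have h3 := D.sum_P_U x (V x) (D.Fₗ x (U x))
  have h4 := D.sum_P_U x (U x) (D.Fₗ x (V x))
  rw [hswap fun b a ↦ D.U x (V x) (e x b) * D.Fₗ x (U x) (e x a)] at h3
  rw [hswap fun b a ↦ D.U x (U x) (e x b) * D.Fₗ x (V x) (e x a)] at h4
  simp only [Fₗ, LinearMap.coe_mk, AddHom.coe_mk, F_n_right] at h3 h4
  linarith

/-- `Ric(v, w) - Ric(w, v) = ds(v, w)`: by the first Bianchi identity the left-hand side is, up to
sign, the trace of the curvature endomorphism. -/
lemma ricci_sub_ricci (v w : TangentSpace (𝓡 m) x) :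
    ricci D.nabla x v w - ricci D.nabla x w v =
      covForm D.nabla D.s x v w - covForm D.nabla D.s x w v := by
  have h := D.sum_co_curv (ext w) (ext v) x
  rw [ext_self, ext_self] at h
  have h1 : covForm D.nabla D.s x v w - covForm D.nabla D.s x w v =
      -∑ a, co (D.curv (ext w) (ext v) (ext (e x a)) x) a := by
    rw [h, neg_sub]
    rfl
  rw [h1, ricci, ricci, ← Finset.sum_sub_distrib, ← Finset.sum_neg_distrib]
  refine Finset.sum_congr rfl fun a _ ↦ ?_
  rw [← co_sub, ← co_neg]
  congr 1
  have h2 := D.bianchi (ext (e x a)) (ext w) x (ext v)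
  rw [D.curv_swap (ext (e x a)) (ext v)] at h2
  rw [curvature_eq, curvature_eq]
  rw [eq_neg_iff_add_eq_zero, ← h2]
  abel

/-- The Ricci tensor contracted with `n` in the first index, from the Ricci identity for `n`. -/
lemma ricci_n (v : TangentSpace (𝓡 m) x) :
    ricci D.nabla x (D.n x) v =
      ∑ a, ∑ b, D.P x a b * covTensor D.nabla D.U x (e x a) v (e x b)
      + D.s x v * D.trP D.U x + covForm D.nabla D.s x (D.n x) v - D.s x (D.nabla D.n x v)
      - dir (D.trP D.U) x v := by
  have hA : ∀ V : VField m N, [SmoothFieldAt V x] →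
      SmoothFieldAt (fun y ↦ D.nabla D.n y (V y)) x := fun V _ ↦
    inferInstanceAs (SmoothFieldAt (D.cov V D.n) x)
  have h1 : ∀ a, curvature D.nabla x (e x a) v (D.n x) =
      D.nablaA (ext v) x (e x a) - D.nablaA (ext (e x a)) x v := fun a ↦ by
    rw [curvature_eq, D.curv_eq_of_eq _ _ x _ D.n (ext_self _), curv_n, ext_self, ext_self]
  simp only [ricci, h1, co_sub, Finset.sum_sub_distrib]
  have h2 : ∑ a, co (D.nablaA (ext (e x a)) x v) a = dir (D.trP D.U) x v := by
    rw [trP_U, D.dir_trace (fun y ↦ D.nabla D.n y) x hA v]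
    rfl
  have h3 : ∑ a, co (D.n x) a * D.ell x (D.nablaA (ext v) x (e x a)) =
      D.ell x (D.nablaA (ext v) x (D.n x)) :=
    sum_co_mul ((D.ell x).toLinearMap ∘ₗ ((D.nabla (D.cov (ext v) D.n) x).toLinearMap
      - (D.nabla D.n x).toLinearMap ∘ₗ (D.nabla (ext v) x).toLinearMap)) (D.n x)
  rw [h2, D.sum_co_eq x fun a ↦ D.nablaA (ext v) x (e x a), h3, ell_nablaA, U_n_left]
  simp only [D.γ_nablaA, ext_self, mul_add, Finset.sum_add_distrib]
  have h4 : ∑ a, ∑ b, D.P x a b * (D.ell x (e x b) * D.U x (e x a) (D.nabla D.n x v)) = 0 := by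
    rw [Finset.sum_comm]
    have h := D.sum_P_ell x fun b ↦ D.U x (e x b) (D.nabla D.n x v)
    have h' := sum_co_mul (D.Uₗ x (D.nabla D.n x v)) (D.n x)
    simp only [Uₗ, LinearMap.coe_mk, AddHom.coe_mk, U_n_right] at h'
    simp only [D.U_symm x (e x _)] at h ⊢
    rw [h', mul_zero] at h
    rw [← h]
    exact Finset.sum_congr rfl fun a _ ↦ Finset.sum_congr rfl fun b _ ↦ by rw [D.P_symm]
  have h5 : ∑ a, ∑ b, D.P x a b * (D.s x v * D.U x (e x a) (e x b)) = D.s x v * D.trP D.U x := by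
    rw [trP, Finset.mul_sum]
    refine Finset.sum_congr rfl fun a _ ↦ ?_
    rw [Finset.mul_sum]
    exact Finset.sum_congr rfl fun b _ ↦ by ring
  have h6 : covForm D.nabla D.s x (D.n x) v =
      dir (app₁ D.s (ext v)) x (D.n x) - D.s x (D.nabla (ext v) x (D.n x)) := rfl
  have h7 : ∀ a b, covTensor D.nabla D.U x (e x a) v (e x b) =
      dir (app₂ D.U (ext v) (ext (e x b))) x (e x a) - D.U x (D.nabla (ext v) x (e x a)) (e x b)
        - D.U x v (D.nabla (ext (e x b)) x (e x a)) := fun a b ↦ rfl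
  have h8 : D.F x (D.n x) (D.nabla D.n x v) = D.s x (D.nabla D.n x v) := rfl
  simp only [h4, h5, h6, h7, h8]
  ring

end NullMetricData

/-! ### Contractions with `n` -/

namespace KTuple

variable {m : ℕ} {N : Type*} [TopologicalSpace N] [ChartedSpace (EuclideanSpace ℝ (Fin m)) N]
  [IsManifold (𝓡 m) ∞ N] (K : KTuple m N)

lemma om_n (x : N) : K.om x (K.n x) = K.κn x := by
  rw [om, K.s_n, zero_sub]; rfl

lemma app₁_om_n : app₁ K.om K.n = K.κn := by ext y; exact K.om_n y

lemma dir_κ (x : N) (v : TangentSpace (𝓡 m) x) :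
    dir K.κ x v = dir (act K.n K.α) x v + K.α x * dir K.κn x v + K.κn x * dir K.α x v := by
  have h : K.κ = act K.n K.α + K.α * app₁ K.om K.n := by rw [app₁_om_n]; rfl
  rw [h, dir_fun_add, dir_fun_mul, app₁_om_n]
  ring

lemma covForm_dα_n (x : N) (v : TangentSpace (𝓡 m) x) : covForm K.nabla K.dα x v (K.n x) =
    dir (act K.n K.α) x v - K.dα x (K.nabla K.n x v) :=
  covForm_nabla_apply K.toNullMetricData K.dα K.n x v

lemma covForm_om_n (x : N) (v : TangentSpace (𝓡 m) x) : covForm K.nabla K.om x v (K.n x) =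
    dir K.κn x v - K.om x (K.nabla K.n x v) := by
  rw [covForm_nabla_apply K.toNullMetricData, app₁_om_n]

lemma covForm_s_n (x : N) (v : TangentSpace (𝓡 m) x) : covForm K.nabla K.s x v (K.n x) =
    - K.s x (K.nabla K.n x v) := by
  have h : app₁ K.s K.n = fun _ ↦ 0 := by ext y; exact K.s_n y
  rw [covForm_nabla_apply K.toNullMetricData, h, dir_const, zero_sub]

/-- The contraction of `£_n Y` with `n` is `£_n r`, here expressed by `∇`. -/
lemma lieDeriv_Y_n (x : N) (v : TangentSpace (𝓡 m) x) :
    lieDeriv K.n K.Y₂ x v (K.n x) =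
      covForm K.nabla K.s x (K.n x) v - covForm K.nabla K.om x (K.n x) v
        + K.r x (K.nabla K.n x v) := by
  have h1 : app₂ K.Y₂ (ext v) K.n = app₁ K.s (ext v) - app₁ K.om (ext v) := by
    ext y
    change K.Y y _ _ = K.s y _ - (K.s y _ - K.Y y _ _)
    rw [K.symm_Y]; ring
  have h2 := K.bracket_eq K.n (ext v) x
  have h3 : covForm K.nabla K.s x (K.n x) v =
      dir (app₁ K.s (ext v)) x (K.n x) - K.s x (K.nabla (ext v) x (K.n x)) := rfl
  have h4 : covForm K.nabla K.om x (K.n x) v =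
      dir (app₁ K.om (ext v)) x (K.n x) - K.om x (K.nabla (ext v) x (K.n x)) := rfl
  rw [lieDeriv_n_apply_right, h1, mlieBracket_self, act_apply, dir_fun_sub, h2, h3, h4]
  simp only [Y₂, NullMetricData.cov, ext_self, map_sub, sub_apply, om, r, Pi.zero_apply, map_zero,
    K.symm_Y x _ (K.n x)]
  ring

/-- Only one half of the symmetrization survives, because `U(n, ·) = 0`. -/
lemma contrP_U_n (T : Tensor2 m N) [IsSmoothTensor T] (x : N) (v : TangentSpace (𝓡 m) x) :
    K.contrP K.U T x v (K.n x) =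
      1 / 2 * (T x (K.n x) (K.nabla K.n x v) - K.s x v * T x (K.n x) (K.n x)) := by
  let θ : TangentSpace (𝓡 m) x →ₗ[ℝ] ℝ :=
    { toFun := T x (K.n x)
      map_add' := IsSmoothTensor.add_right x _
      map_smul' := fun c w ↦ IsSmoothTensor.smul_right x c _ w }
  have h : _ = T x (K.n x) (K.nabla K.n x v) - K.s x v * T x (K.n x) (K.n x) := K.sum_P_U x v θ
  rw [← h, contrP, symm, Finset.sum_comm]
  simp only [K.U_n_right, mul_zero, zero_mul, Finset.sum_const_zero, add_zero]
  congr 1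
  refine Finset.sum_congr rfl fun a _ ↦ Finset.sum_congr rfl fun b _ ↦ ?_
  rw [K.P_symm, K.U_symm, mul_assoc]
  rfl

/-- The Leibniz rule for `P^{bc} ∇_b (α U_{ac})`, with `P^{bc} U_{ac}` read off from `∇n`. -/
lemma div_αU (x : N) (v : TangentSpace (𝓡 m) x) :
    ∑ b, ∑ c, K.P x b c * covTensor K.nabla K.αU x (e x b) v (e x c) =
      K.α x * ∑ b, ∑ c, K.P x b c * covTensor K.nabla K.U x (e x b) v (e x c)
        + K.dα x (K.nabla K.n x v) - K.s x v * K.dα x (K.n x) := by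
  let θ : TangentSpace (𝓡 m) x →ₗ[ℝ] ℝ :=
    { toFun := K.dα x
      map_add' := IsSmoothForm.add x
      map_smul' := fun c w ↦ IsSmoothForm.smul x c w }
  have h : _ = K.dα x (K.nabla K.n x v) - K.s x v * K.dα x (K.n x) := K.sum_P_U x v θ
  have h1 : ∀ b c, covTensor K.nabla K.αU x (e x b) v (e x c) =
      K.α x * covTensor K.nabla K.U x (e x b) v (e x c) + K.U x v (e x c) * K.dα x (e x b) := by
    intro b c
    have h2 := dir_fun_mul K.α (app₂ K.U (ext v) (ext (e x c))) x (e x b)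
    change dir (K.α * app₂ K.U (ext v) (ext (e x c))) x (e x b) - K.α x * K.U x _ _
      - K.α x * K.U x _ _ = K.α x * (dir (app₂ K.U (ext v) (ext (e x c))) x (e x b) - _ - _) + _
    rw [h2, app₂_apply, ext_self, ext_self, dα]
    ring
  rw [add_sub_assoc, ← h, Finset.mul_sum, ← Finset.sum_add_distrib]
  refine Finset.sum_congr rfl fun b _ ↦ ?_
  rw [Finset.mul_sum, ← Finset.sum_add_distrib]
  refine Finset.sum_congr rfl fun c _ ↦ ?_
  rw [h1]
  change _ = _ + K.P x b c * (K.U x v (e x c) * K.dα x (e x b))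
  ring

end KTuple

end NullHypersurface

/-! ### The generalized near-horizon equation -/

theorem theorem1 {m : ℕ} {N : Type*} [TopologicalSpace N]
    [ChartedSpace (EuclideanSpace ℝ (Fin m)) N] [IsManifold (𝓡 m) ∞ N]
    (K : NullHypersurface.KTuple m N) :
    (∀ (x : N) (v w : TangentSpace (𝓡 m) x),
      0 = NullHypersurface.covForm K.nabla K.dα x v w
        + (K.om x v * K.dα x w + K.om x w * K.dα x v)
        + K.α x / 2 * (2 * NullHypersurface.symm (NullHypersurface.covForm K.nabla K.om) x v w
            + 2 * (K.om x v * K.om x w) + K.constraint x v w - NullHypersurface.symm K.Ric x v w)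
        + (K.κ x + K.α x / 2 * K.trP K.U x) * K.Y x v w
        + K.α x / 2 * K.trP K.Y₂ x * K.U x v w
        - 2 * K.α x * K.contrP K.U K.Y₂ x v w
        - K.Pi x v w
        + K.α x / 2 * (NullHypersurface.symm (NullHypersurface.covForm K.nabla K.s) x v w
            - K.s x v * K.s x w)
        + 1 / 2 * (K.α x * NullHypersurface.dir K.ell2 x (K.n x) + K.p x) * K.U x v w
        - K.α x * K.contrP K.U K.F x v w) ∧
    (∀ (x : N) (v : TangentSpace (𝓡 m) x),
      0 = NullHypersurface.dir K.κ x v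
        + K.α x * (K.constraint x v (K.n x) - K.trP K.U x * K.om x v
            + NullHypersurface.dir (K.trP K.U) x v)
        - ∑ b, ∑ c, K.P x b c * NullHypersurface.covTensor K.nabla K.αU x
            (NullHypersurface.e x b) v (NullHypersurface.e x c)
        - K.Pi x v (K.n x)) ∧
    (∀ x : N, 0 = NullHypersurface.dir K.κ x (K.n x) - K.Pi x (K.n x) (K.n x)) := by
  refine ⟨fun x v w ↦ ?_, fun x v ↦ ?_, fun x ↦ ?_⟩
  · -- The symmetrized Ricci tensor cancels, and `ω(n) = κ_n`.
    have h := K.om_n x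
    rw [K.Pi_eq]
    simp only [NullHypersurface.KTuple.constraint, NullHypersurface.symm,
      NullHypersurface.KTuple.κ, NullHypersurface.KTuple.Y₂, h]
    ring
  · have h1 := K.ricci_n x v
    have h2 := K.ricci_sub_ricci x (K.n x) v
    have h3 : K.contrP K.U K.Y₂ x v (K.n x) =
      1 / 2 * (K.r x (K.nabla K.n x v) + K.s x v * K.κn x) := by
      rw [K.contrP_U_n]
      simp only [NullHypersurface.KTuple.Y₂, NullHypersurface.KTuple.κn,
        NullHypersurface.KTuple.r]
      ring
    have h4 : K.contrP K.U K.F x v (K.n x) = 1 / 2 * K.s x (K.nabla K.n x v) := by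
      rw [K.contrP_U_n, K.F_n_right, K.s_n, neg_zero, mul_zero, sub_zero]
      rfl
    have h5 : K.Y x v (K.n x) = K.s x v - K.om x v := by
      rw [K.symm_Y, NullHypersurface.KTuple.om, sub_sub_cancel]
      rfl
    have h6 : K.om x (K.nabla K.n x v) =
      K.s x (K.nabla K.n x v) - K.r x (K.nabla K.n x v) := rfl
    rw [K.Pi_eq, K.dir_κ, K.div_αU, K.covForm_dα_n, K.lieDeriv_Y_n, K.covForm_s_n, K.U_n_right,
      K.om_n, h5]
    simp only [NullHypersurface.KTuple.constraint, NullHypersurface.symm,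
      NullHypersurface.KTuple.Ric, K.covForm_om_n, K.covForm_s_n, K.lieDeriv_Y_n, h3, h4, K.om_n,
      K.U_n_right, K.s_n, NullHypersurface.KTuple.Y₂, h5] at *
    rw [h6]
    simp only [NullHypersurface.KTuple.dα]
    -- `h1` gives the Ricci term up to its antisymmetric part, which is `h2`.
    linear_combination (-K.α x) * h1 + K.α x / 2 * h2
  · have h1 := NullHypersurface.IsSmoothForm.zero K.om x
    have h2 := NullHypersurface.IsSmoothForm.zero K.s x
    have h3 := NullHypersurface.IsSmoothForm.zero K.r x
    have h4 := NullHypersurface.IsSmoothForm.zero K.dα x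
    have h5 : K.Y x (K.n x) (K.n x) = - K.κn x := (neg_neg _).symm
    have h6 : K.dα x (K.n x) = NullHypersurface.dir K.α x (K.n x) := rfl
    rw [K.Pi_eq, K.dir_κ, K.covForm_dα_n, K.lieDeriv_Y_n, K.covForm_s_n, K.covForm_om_n,
      K.U_n_right, K.om_n, K.nabla_n_n, h1, h2, h3, h4, h5, h6]
    ring
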